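/- Let $n\ge 4$ be an even integer, let $u\in C^\infty(\mathbb{R}^n)$, and let $g=e^{2u}|dx|^2$ be the corresponding conformal metric on $\mathbb{R}^n$, with scalar curvature $R_g$ and Q-curvature $Q$, where $Q$ is the function determined by $(-\Delta)^{n/2}u=Q\,e^{nu}$. Assume that 1. $g$ is complete; 2. $g$ has finite total Q-curvature, i.e. $Qe^{nu}\in L^1(\mathbb{R}^n)$; 3. $g$ is normal, i.e. there is a constant $C$ such that for all $x\in\mathbb{R}^n$ $$u(x)=\frac{2}{(n-1)!\,|\mathbb{S}^n|}\int_{\mathbb{R}^n}\log\frac{|y|}{|x-y|}\,Q(y)e^{nu(y)}\,dy+C,$$ where $|\mathbb{S}^n|$ is the volume of the standard $n$-sphere; 4. $Q\ge 0$ on $\mathbb{R}^n$. Define the conformal mass of $g$ by $$m_c(g):=\frac{1}{(n-1)(n-2)|\mathbb{S}^{n-1}|}\,\inf_{x\in\mathbb{R}^n}\,\liminf_{r\to\infty}\, r^{3-n}\int_{\partial B_r(x)}R_g\,e^{2u}\,d\sigma\ \in[-\infty,+\infty],$$ where $B_r(x)$ is the Euclidean ball and $d\sigma$ is the Euclidean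 area element on $\partial B_r(x)$. Then $$m_c(g)\ge 0,$$ and $m_c(g)=0$ if and only if $u$ is constant. -/

import Mathlib

open MeasureTheory Filter Topology
open scoped ContDiff Manifold ENNReal

noncomputable section

namespace ConformalMass

/-! ### Riemannian metrics on `ℝⁿ` in the standard coordinates -/

/-- A field of matrices `(g_{ij}(x))` on `ℝⁿ`, the components of a metric tensor in the
standard global chart. -/
abbrev MetricField (n : ℕ) : Type := EuclideanSpace ℝ (Fin n) → Matrix (Fin n) (Fin n) ℝ

/-- The partial derivative `∂_i f (x)`. -/
def partialDeriv {n : ℕ} (i : Fin n) (f : EuclideanSpace ℝ (Fin n) → ℝ)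
    (x : EuclideanSpace ℝ (Fin n)) : ℝ :=
  fderiv ℝ f x (EuclideanSpace.single i 1)

/-- The Christoffel symbol
`Γ^k_{ij} = (1/2) ∑_l g^{kl} (∂_i g_{jl} + ∂_j g_{il} - ∂_l g_{ij})`. -/
def christoffel {n : ℕ} (g : MetricField n) (k i j : Fin n) (x : EuclideanSpace ℝ (Fin n)) : ℝ :=
  (1 / 2) * ∑ l, (g x)⁻¹ k l *
    (partialDeriv i (fun y => g y j l) x + partialDeriv j (fun y => g y i l) x
      - partialDeriv l (fun y => g y i j) x)

/-- The Ricci tensor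
`Ric_{ij} = ∑_k (∂_k Γ^k_{ij} - ∂_j Γ^k_{ik}) + ∑_{k,l} (Γ^k_{kl} Γ^l_{ij} - Γ^k_{jl} Γ^l_{ik})`. -/
def ricci {n : ℕ} (g : MetricField n) (i j : Fin n) (x : EuclideanSpace ℝ (Fin n)) : ℝ :=
  (∑ k, (partialDeriv k (christoffel g k i j) x - partialDeriv j (christoffel g k i k) x))
    + ∑ k, ∑ l, (christoffel g k k l x * christoffel g l i j x
        - christoffel g k j l x * christoffel g l i k x)

/-- The scalar curvature `R_g = ∑_{i,j} g^{ij} Ric_{ij}`. -/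
def scalarCurvature {n : ℕ} (g : MetricField n) (x : EuclideanSpace ℝ (Fin n)) : ℝ :=
  ∑ i, ∑ j, (g x)⁻¹ i j * ricci g i j x

/-- The length `√(g_x(v, v))` of a tangent vector `v` at `x`. -/
def tangentLength {n : ℕ} (g : MetricField n) (x v : EuclideanSpace ℝ (Fin n)) : ℝ :=
  Real.sqrt (∑ i, ∑ j, g x i j * v i * v j)

/-- The Riemannian distance of the metric `g` on `ℝⁿ`: the infimum of the `g`-lengths of the
`C¹` paths from `x` to `y`. -/
def riemDist {n : ℕ} (g : MetricField n) (x y : EuclideanSpace ℝ (Fin n)) : ℝ≥0∞ :=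
  @Manifold.riemannianEDist _ _ _ _ _ 𝓘(ℝ, EuclideanSpace ℝ (Fin n))
    (EuclideanSpace ℝ (Fin n)) _ _
    (fun p => ⟨fun v => ENNReal.ofReal (tangentLength g p v)⟩) x y

/-- The metric `g` is complete: every Cauchy sequence for its Riemannian distance converges for
this distance. -/
def IsCompleteMetric {n : ℕ} (g : MetricField n) : Prop :=
  ∀ s : ℕ → EuclideanSpace ℝ (Fin n),
    (∀ ε : ℝ≥0∞, 0 < ε → ∃ N : ℕ, ∀ k ≥ N, ∀ l ≥ N, riemDist g (s k) (s l) < ε) →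
      ∃ x, Tendsto (fun k => riemDist g (s k) x) atTop (𝓝 0)

/-! ### Conformal metrics -/

/-- The conformal metric `g = e^{2u} |dx|²`. -/
def conformalMetric {n : ℕ} (u : EuclideanSpace ℝ (Fin n) → ℝ) : MetricField n :=
  fun x => Real.exp (2 * u x) • (1 : Matrix (Fin n) (Fin n) ℝ)

/-- The operator `(-Δ)^m` on functions on `ℝⁿ`. -/
def negLaplacianPow {n : ℕ} (m : ℕ) (u : EuclideanSpace ℝ (Fin n) → ℝ) :
    EuclideanSpace ℝ (Fin n) → ℝ :=
  (fun (f : EuclideanSpace ℝ (Fin n) → ℝ) (x : EuclideanSpace ℝ (Fin n)) =>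
    -(Laplacian.laplacian f x))^[m] u

/-- The Q-curvature (of order `n`, for even `n`) of `g = e^{2u} |dx|²`, that is, the function `Q`
with `(-Δ)^{n/2} u = Q e^{nu}`. -/
def qCurvature {n : ℕ} (u : EuclideanSpace ℝ (Fin n) → ℝ) (x : EuclideanSpace ℝ (Fin n)) : ℝ :=
  Real.exp (-(n * u x)) * negLaplacianPow (n / 2) u x

/-- Finite total Q-curvature: `Q e^{nu} ∈ L¹(ℝⁿ)`. -/
def HasFiniteTotalQ {n : ℕ} (u : EuclideanSpace ℝ (Fin n) → ℝ) : Prop :=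
  Integrable (fun y => qCurvature u y * Real.exp (n * u y))

/-- The area of the unit sphere of `ℝᵐ`, so that `|𝕊ⁿ| = unitSphereArea (n + 1)` and
`|𝕊ⁿ⁻¹| = unitSphereArea n`. -/
def unitSphereArea (m : ℕ) : ℝ :=
  (volume : Measure (EuclideanSpace ℝ (Fin m))).toSphere.real Set.univ

/-- The metric `e^{2u} |dx|²` is normal: for some constant `C` and all `x`,
`u(x) = 2 / ((n-1)! |𝕊ⁿ|) ∫ log (|y| / |x-y|) Q(y) e^{nu(y)} dy + C`. -/
def IsNormal {n : ℕ} (u : EuclideanSpace ℝ (Fin n) → ℝ) : Prop :=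
  ∃ C : ℝ, ∀ x, u x = 2 / ((Nat.factorial (n - 1) : ℝ) * unitSphereArea (n + 1)) *
    (∫ y, Real.log (‖y‖ / ‖x - y‖) * (qCurvature u y * Real.exp (n * u y))) + C

/-- The integral `∫_{∂B_r(x)} f dσ` with respect to the Euclidean area element, for `r > 0`
(pulled back to the unit sphere by `θ ↦ x + r θ`). -/
def sphereIntegral {n : ℕ} (f : EuclideanSpace ℝ (Fin n) → ℝ) (x : EuclideanSpace ℝ (Fin n))
    (r : ℝ) : ℝ :=
  r ^ (n - 1) * ∫ θ : Metric.sphere (0 : EuclideanSpace ℝ (Fin n)) 1,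
    f (x + r • (θ : EuclideanSpace ℝ (Fin n)))
      ∂(volume : Measure (EuclideanSpace ℝ (Fin n))).toSphere

/-- The conformal mass of `g = e^{2u} |dx|²`, an extended real number:
`1 / ((n-1)(n-2)|𝕊ⁿ⁻¹|) · inf_x liminf_{r → ∞} r^{3-n} ∫_{∂B_r(x)} R_g e^{2u} dσ`. -/
def conformalMass {n : ℕ} (u : EuclideanSpace ℝ (Fin n) → ℝ) : EReal :=
  ((1 / (((n : ℝ) - 1) * ((n : ℝ) - 2) * unitSphereArea n) : ℝ) : EReal) *
    ⨅ x : EuclideanSpace ℝ (Fin n), liminf (fun r : ℝ =>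
      ((r ^ (3 - (n : ℤ)) * sphereIntegral
        (fun y => scalarCurvature (conformalMetric u) y * Real.exp (2 * u y)) x r : ℝ) : EReal))
      atTop

end ConformalMass

end

/-! Put `f = Q e^{nu} = (-Δ)^{n/2} u`, which is nonnegative, continuous and integrable, and `α = c ∫
f` with `c` the constant of normality. Then `u` is, up to a constant, `c` times the logarithmic
potential of `f`, and the proof compares its gradient and Laplacian, then bounds `α` by
completeness.

Conformal change gives `R_g e^{2u} = -2(n-1) Δu - (n-1)(n-2) |∇u|²`. With `V(x) = ∫ |x-y|⁻² f(y)
dy`, differentiation under the integral gives `Δu = -(n-2) c V`, while Cauchy–Schwarz gives `|∇u|² ≤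
α c V`. Hence `R_g e^{2u} ≥ (n-1)(n-2)(2-α) c V` (`le_scalarCurvature_log_potential`). On the sphere
of radius `r` about any centre, `r² V` is bounded below by a quantity tending to `∫ f`, so the mass
is at least `(2-α) α` (`le_conformalMass`).

Completeness forces `α < 2` (`mul_integral_lt_two`). If `α ≥ 2`, then `u` decays like `-(3/2) log
|x|` up to local singular terms that are harmless on average, so `e^u |x|^{1-n}` is integrable near
infinity. In polar coordinates almost every ray then has finite length near infinity, whereas every
ray of a complete metric is infinitely long.

So the mass is nonnegative, and mass zero forces `α = 0`, then `f = 0`, and `u` is constant. -/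

noncomputable section

namespace ConformalMass

/-! ### Curvature of a conformally flat metric -/

section

variable {n : ℕ} {u : EuclideanSpace ℝ (Fin n) → ℝ}

theorem conformalMetric_apply (u : EuclideanSpace ℝ (Fin n) → ℝ) (x : EuclideanSpace ℝ (Fin n))
    (i j : Fin n) :
    conformalMetric u x i j = if i = j then Real.exp (2 * u x) else 0 := by
  simp [conformalMetric, Matrix.one_apply]

theorem conformalMetric_inv_apply (u : EuclideanSpace ℝ (Fin n) → ℝ)
    (x : EuclideanSpace ℝ (Fin n)) (i j : Fin n) :
    (conformalMetric u x)⁻¹ i j = if i = j then Real.exp (-(2 * u x)) else 0 := by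
  have : (conformalMetric u x)⁻¹ = Real.exp (-(2 * u x)) • (1 : Matrix (Fin n) (Fin n) ℝ) := by
    apply Matrix.inv_eq_left_inv
    simp [conformalMetric, smul_smul, ← Real.exp_add]
  simp [this, Matrix.one_apply]

theorem partialDeriv_conformalMetric (hu : Differentiable ℝ u) (x : EuclideanSpace ℝ (Fin n))
    (i j l : Fin n) :
    partialDeriv i (fun y => conformalMetric u y j l) x =
      if j = l then 2 * Real.exp (2 * u x) * partialDeriv i u x else 0 := by
  simp only [conformalMetric_apply, partialDeriv]
  split_ifs with h
  · have := (((hu x).hasFDerivAt.const_mul 2).exp).fderiv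
    rw [this]
    simp
    ring
  · simp

theorem christoffel_conformalMetric (hu : Differentiable ℝ u) (k i j : Fin n)
    (x : EuclideanSpace ℝ (Fin n)) :
    christoffel (conformalMetric u) k i j x =
      (if j = k then partialDeriv i u x else 0) + (if i = k then partialDeriv j u x else 0)
        - (if i = j then partialDeriv k u x else 0) := by
  have h : Real.exp (-(2 * u x)) * Real.exp (2 * u x) = 1 := by simp [← Real.exp_add]
  simp only [christoffel, conformalMetric_inv_apply, partialDeriv_conformalMetric hu, ite_mul,
    zero_mul, Finset.sum_ite_eq, Finset.mem_univ, if_true]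
  simp only [← mul_ite_zero]
  linear_combination ((if j = k then partialDeriv i u x else 0)
    + (if i = k then partialDeriv j u x else 0) - (if i = j then partialDeriv k u x else 0)) * h

theorem partialDeriv_differentiable (hu : ContDiff ℝ 2 u) (i : Fin n) :
    Differentiable ℝ (partialDeriv i u) :=
  ((hu.fderiv_right (m := 1) (by norm_num)).differentiable (by norm_num)).clm_apply
    (differentiable_const _)

theorem partialDeriv_christoffel (hu : ContDiff ℝ 2 u) (m k i j : Fin n)
    (x : EuclideanSpace ℝ (Fin n)) :
    partialDeriv m (christoffel (conformalMetric u) k i j) x =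
      (if j = k then partialDeriv m (partialDeriv i u) x else 0)
        + (if i = k then partialDeriv m (partialDeriv j u) x else 0)
        - (if i = j then partialDeriv m (partialDeriv k u) x else 0) := by
  have hd := fun i => (partialDeriv_differentiable hu i) x
  have : christoffel (conformalMetric u) k i j = fun x =>
      (if j = k then (1 : ℝ) else 0) * partialDeriv i u x
        + (if i = k then (1 : ℝ) else 0) * partialDeriv j u x
        - (if i = j then (1 : ℝ) else 0) * partialDeriv k u x := by
    ext x
    rw [christoffel_conformalMetric (hu.differentiable (by norm_num))]
    simp
  have hder := ((((hd i).hasFDerivAt.const_mul (if j = k then (1 : ℝ) else 0)).add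
    ((hd j).hasFDerivAt.const_mul (if i = k then (1 : ℝ) else 0))).sub
    ((hd k).hasFDerivAt.const_mul (if i = j then (1 : ℝ) else 0))).fderiv
  rw [this]
  unfold partialDeriv at hder ⊢
  erw [hder]
  split_ifs <;> simp

/-- Diagonal entries suffice for the scalar curvature because the inverse metric is diagonal. -/
theorem ricci_conformalMetric_diag (hu : ContDiff ℝ 2 u) (i : Fin n)
    (x : EuclideanSpace ℝ (Fin n)) :
    ricci (conformalMetric u) i i x =
      (2 - n) * partialDeriv i (partialDeriv i u) x - ∑ k, partialDeriv k (partialDeriv k u) x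
        + (n - 2) * (partialDeriv i u x) ^ 2 - (n - 2) * ∑ k, (partialDeriv k u x) ^ 2 := by
  have hd := hu.differentiable (by norm_num)
  have h1 : ∑ k, (partialDeriv k (christoffel (conformalMetric u) k i i) x
      - partialDeriv i (christoffel (conformalMetric u) k i k) x) =
      (2 - n) * partialDeriv i (partialDeriv i u) x
        - ∑ k, partialDeriv k (partialDeriv k u) x := by
    have : ∀ k, partialDeriv k (christoffel (conformalMetric u) k i i) x
      - partialDeriv i (christoffel (conformalMetric u) k i k) x =
      (if i = k then 2 * partialDeriv k (partialDeriv i u) x else 0)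
       - partialDeriv k (partialDeriv k u) x - partialDeriv i (partialDeriv i u) x := by
      intro k
      simp only [partialDeriv_christoffel hu]
      split_ifs <;> simp_all
      ring
    simp only [this, Finset.sum_sub_distrib, Finset.sum_ite_eq, Finset.mem_univ, if_true,
      Finset.sum_const, Finset.card_univ, Fintype.card_fin, nsmul_eq_mul]
    ring
  have h2 : ∑ k, ∑ l, christoffel (conformalMetric u) k k l x *
      christoffel (conformalMetric u) l i i x =
      2 * n * (partialDeriv i u x) ^ 2 - n * ∑ k, (partialDeriv k u x) ^ 2 := by
    have : ∀ k l, christoffel (conformalMetric u) k k l x *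
      christoffel (conformalMetric u) l i i x =
      (if i = l then 2 * partialDeriv i u x ^ 2 else 0) - partialDeriv l u x ^ 2 := by
      intro k l
      simp only [christoffel_conformalMetric hd]
      by_cases h : i = l <;> by_cases h' : k = l <;> simp_all [eq_comm] <;> ring
    simp only [this, Finset.sum_sub_distrib, Finset.sum_ite_eq, Finset.mem_univ, if_true,
      Finset.sum_const, Finset.card_univ, Fintype.card_fin, nsmul_eq_mul]
    ring
  have h3 : ∑ k, ∑ l, christoffel (conformalMetric u) k i l x *
      christoffel (conformalMetric u) l i k x =
      (n + 2) * (partialDeriv i u x) ^ 2 - 2 * ∑ k, (partialDeriv k u x) ^ 2 := by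
    have : ∀ k l, christoffel (conformalMetric u) k i l x *
      christoffel (conformalMetric u) l i k x =
      (if l = k then partialDeriv i u x ^ 2 else 0)
        + (if i = k then if i = l then 2 * partialDeriv i u x ^ 2 else 0 else 0)
        - (if i = k then partialDeriv l u x ^ 2 else 0)
        - (if i = l then partialDeriv k u x ^ 2 else 0) := by
      intro k l
      simp only [christoffel_conformalMetric hd]
      by_cases h : i = l <;> by_cases h' : i = k <;> by_cases h'' : k = l <;>
        simp_all [eq_comm] <;> ring
    simp only [this, Finset.sum_sub_distrib, Finset.sum_add_distrib, Finset.sum_ite_eq,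
      Finset.mem_univ, if_true, Finset.sum_const, Finset.card_univ, Fintype.card_fin,
      nsmul_eq_mul, Finset.sum_ite_irrel]
    simp
    ring
  rw [ricci, h1]
  simp only [Finset.sum_sub_distrib]
  rw [h2, h3]
  ring

/-- The scalar curvature of a conformally flat metric `e^{2u} |dx|²`. -/
theorem scalarCurvature_conformalMetric (hu : ContDiff ℝ 2 u) (x : EuclideanSpace ℝ (Fin n)) :
    scalarCurvature (conformalMetric u) x * Real.exp (2 * u x) =
      -(2 * (n - 1)) * ∑ k, partialDeriv k (partialDeriv k u) x
        - (n - 1) * (n - 2) * ∑ k, (partialDeriv k u x) ^ 2 := by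
  have h : Real.exp (-(2 * u x)) * Real.exp (2 * u x) = 1 := by simp [← Real.exp_add]
  have : scalarCurvature (conformalMetric u) x =
      Real.exp (-(2 * u x)) * ∑ i, ricci (conformalMetric u) i i x := by
    simp [scalarCurvature, conformalMetric_inv_apply, Finset.mul_sum]
  rw [this, mul_right_comm, h, one_mul]
  simp only [ricci_conformalMetric_diag hu, Finset.sum_sub_distrib, Finset.sum_add_distrib,
    ← Finset.mul_sum, Finset.sum_const, Finset.card_univ, Fintype.card_fin, nsmul_eq_mul]
  ring

end

section

/-! ### Convolution with singular kernels -/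

/-- A kernel on `ℝⁿ` that is continuous off the origin and `O(‖z‖⁻ᵖ)`. -/
structure IsSingularKernel {n : ℕ} (p : ℕ) (k : EuclideanSpace ℝ (Fin n) → ℝ) : Prop where
  continuousOn : ContinuousOn k {0}ᶜ
  bound : ∃ M, 0 ≤ M ∧ ∀ z ≠ 0, |k z| ≤ M * (‖z‖ ^ p)⁻¹

variable {n p : ℕ} {k f : EuclideanSpace ℝ (Fin n) → ℝ}

theorem integrableOn_norm_pow_inv (hp : p < n) :
    IntegrableOn (fun z : EuclideanSpace ℝ (Fin n) => (‖z‖ ^ p)⁻¹) (Metric.ball 0 1) := by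
  have : Nontrivial (EuclideanSpace ℝ (Fin n)) :=
    Module.nontrivial_of_finrank_pos (R := ℝ) (by simp; omega)
  rw [integrableOn_fun_norm_addHaar volume (f := fun y => (y ^ p)⁻¹)]
  have : IntegrableOn (fun y : ℝ => y ^ (n - 1 - p)) (Set.Ioo 0 1) :=
    ((continuous_pow _).integrableOn_Icc (a := 0) (b := 1)).mono_set Set.Ioo_subset_Icc_self
  refine this.congr_fun (fun y hy => ?_) measurableSet_Ioo
  have hy0 : y ≠ 0 := hy.1.ne'
  have : n - 1 = (n - 1 - p) + p := by omega
  simp only [finrank_euclideanSpace, Fintype.card_fin, smul_eq_mul]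
  conv_rhs => rw [this, pow_add]
  field_simp

namespace IsSingularKernel

theorem measurable (hk : IsSingularKernel p k) : Measurable k :=
  measurable_of_continuousOn_compl_singleton 0 hk.continuousOn

theorem abs (hk : IsSingularKernel p k) : IsSingularKernel p (fun z => |k z|) where
  continuousOn := hk.continuousOn.abs
  bound := by simpa using hk.bound

theorem integrableOn_ball (hk : IsSingularKernel p k) (hp : p < n) :
    IntegrableOn k (Metric.ball 0 1) := by
  obtain ⟨M, -, hM⟩ := hk.bound
  have : Nontrivial (EuclideanSpace ℝ (Fin n)) :=
    Module.nontrivial_of_finrank_pos (R := ℝ) (by simp; omega)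
  refine ((integrableOn_norm_pow_inv hp).const_mul M).mono' hk.measurable.aestronglyMeasurable ?_
  refine ae_restrict_of_ae ?_
  filter_upwards [compl_mem_ae_iff.2 (measure_singleton (0 : EuclideanSpace ℝ (Fin n)))] with z hz
  exact hM z hz

theorem exists_bound_far (hk : IsSingularKernel p k) : ∃ M, 0 ≤ M ∧ ∀ z, 1 ≤ ‖z‖ → |k z| ≤ M := by
  obtain ⟨M, hM0, hM⟩ := hk.bound
  refine ⟨M, hM0, fun z hz => (hM z (norm_pos_iff.1 (by linarith))).trans ?_⟩
  exact mul_le_of_le_one_right hM0 (inv_le_one_of_one_le₀ (one_le_pow₀ hz))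

theorem integrable_near (hk : IsSingularKernel p k) (hp : p < n) (hf : Continuous f)
    (x : EuclideanSpace ℝ (Fin n)) :
    IntegrableOn (fun z => k z * f (x - z)) (Metric.ball 0 1) := by
  obtain ⟨S, hS⟩ := (isCompact_closedBall (0 : EuclideanSpace ℝ (Fin n)) 1).exists_bound_of_continuousOn
    (f := fun z => f (x - z)) (by fun_prop)
  refine Integrable.mul_bdd (c := S) (hk.integrableOn_ball hp)
    (by fun_prop : Continuous fun z => f (x - z)).aestronglyMeasurable ?_
  refine (ae_restrict_mem measurableSet_ball).mono fun z hz => hS z (Metric.ball_subset_closedBall hz)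

theorem indicator_far_bound (hk : IsSingularKernel p k) : ∃ M, 0 ≤ M ∧
    ∀ z, ‖(Metric.ball 0 1)ᶜ.indicator k z‖ ≤ M := by
  obtain ⟨M, hM0, hM⟩ := hk.exists_bound_far
  refine ⟨M, hM0, fun z => ?_⟩
  by_cases hz : z ∈ (Metric.ball (0 : EuclideanSpace ℝ (Fin n)) 1)ᶜ
  · rw [Set.indicator_of_mem hz]
    exact hM z (by simpa using hz)
  · rw [Set.indicator_of_notMem hz]
    simpa

theorem integrable_far (hk : IsSingularKernel p k) (hfi : Integrable f)
    (x : EuclideanSpace ℝ (Fin n)) :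
    Integrable (fun y => (Metric.ball 0 1)ᶜ.indicator k (x - y) * f y) := by
  obtain ⟨M, -, hM⟩ := hk.indicator_far_bound
  refine Integrable.bdd_mul (c := M) hfi ?_ (ae_of_all _ fun y => hM _)
  exact ((hk.measurable.indicator measurableSet_ball.compl).comp
    (measurable_const.sub measurable_id)).aestronglyMeasurable

theorem integrable_near' (hk : IsSingularKernel p k) (hp : p < n) (hf : Continuous f)
    (x : EuclideanSpace ℝ (Fin n)) :
    Integrable (fun y => (Metric.ball 0 1).indicator k (x - y) * f y) := by
  have h := (hk.integrable_near hp hf x).integrable_indicator measurableSet_ball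
  have h2 := h.comp_sub_left x
  refine h2.congr (ae_of_all _ fun y => ?_)
  simp only [Set.indicator]
  split_ifs <;> simp

theorem split (k : EuclideanSpace ℝ (Fin n) → ℝ) (z : EuclideanSpace ℝ (Fin n)) :
    k z = (Metric.ball 0 1).indicator k z + (Metric.ball 0 1)ᶜ.indicator k z :=
  (congrFun (Set.indicator_self_add_compl (Metric.ball 0 1) k) z).symm

/-- Near the singularity the kernel is integrable and `f` is locally bounded; away from it the
kernel is bounded and `f` is integrable. No global bound on `f` is needed. -/
theorem integrable (hk : IsSingularKernel p k) (hp : p < n) (hf : Continuous f)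
    (hfi : Integrable f) (x : EuclideanSpace ℝ (Fin n)) :
    Integrable (fun y => k (x - y) * f y) := by
  refine ((hk.integrable_near' hp hf x).add (hk.integrable_far hfi x)).congr
    (ae_of_all _ fun y => ?_)
  simp only [Pi.add_apply]
  rw [split k (x - y), add_mul]

/-- Dominated convergence on each piece. In the near piece the translation is moved onto `f`, so the
singularity stays fixed. -/
theorem continuous_integral (hk : IsSingularKernel p k) (hp : p < n) (hf : Continuous f)
    (hfi : Integrable f) : Continuous (fun x => ∫ y, k (x - y) * f y) := by
  have : Nontrivial (EuclideanSpace ℝ (Fin n)) :=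
    Module.nontrivial_of_finrank_pos (R := ℝ) (by simp; omega)
  have heq : (fun x => ∫ y, k (x - y) * f y) = fun x =>
      (∫ z in Metric.ball 0 1, k z * f (x - z))
        + ∫ y, (Metric.ball 0 1)ᶜ.indicator k (x - y) * f y := by
    ext x
    have h1 : ∫ z in Metric.ball 0 1, k z * f (x - z) =
        ∫ y, (Metric.ball 0 1).indicator k (x - y) * f y := by
      rw [← integral_indicator measurableSet_ball, ← integral_sub_left_eq_self _ volume x]
      congr 1
      ext y
      simp only [Set.indicator]
      split_ifs <;> simp
    rw [h1, ← integral_add (hk.integrable_near' hp hf x) (hk.integrable_far hfi x)]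
    congr 1
    ext y
    rw [split k (x - y), add_mul]
  rw [heq]
  refine Continuous.add ?_ ?_
  · rw [continuous_iff_continuousAt]
    intro x₀
    obtain ⟨S, hS⟩ := (isCompact_closedBall x₀ 2).exists_bound_of_continuousOn hf.continuousOn
    refine continuousAt_of_dominated (bound := fun z => |k z| * S) ?_ ?_
      ((hk.integrableOn_ball hp).abs.mul_const S) ?_
    · exact Eventually.of_forall fun x => (hk.integrable_near hp hf x).aestronglyMeasurable
    · filter_upwards [Metric.ball_mem_nhds x₀ one_pos] with x hx
      refine (ae_restrict_mem measurableSet_ball).mono fun z hz => ?_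
      rw [norm_mul, Real.norm_eq_abs]
      refine mul_le_mul_of_nonneg_left (hS _ ?_) (abs_nonneg _)
      rw [Metric.mem_closedBall, dist_eq_norm]
      rw [Metric.mem_ball, dist_eq_norm] at hx
      have hz' : ‖z‖ < 1 := by simpa using hz
      calc ‖x - z - x₀‖ = ‖(x - x₀) - z‖ := by congr 1; abel
        _ ≤ ‖x - x₀‖ + ‖z‖ := norm_sub_le _ _
        _ ≤ 2 := by linarith
    · exact ae_of_all _ fun z => by fun_prop
  · obtain ⟨M, -, hM⟩ := hk.indicator_far_bound
    rw [continuous_iff_continuousAt]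
    intro x₀
    refine continuousAt_of_dominated (bound := fun y => M * |f y|) ?_ ?_ (hfi.abs.const_mul M) ?_
    · exact Eventually.of_forall fun x => (hk.integrable_far hfi x).aestronglyMeasurable
    · refine Eventually.of_forall fun x => ae_of_all _ fun y => ?_
      rw [norm_mul, Real.norm_eq_abs (f y)]
      exact mul_le_mul_of_nonneg_right (hM _) (abs_nonneg _)
    -- Truncation makes the kernel jump only on the unit sphere about `x₀`, a null set.
    · filter_upwards [compl_mem_ae_iff.2 (Measure.addHaar_sphere volume x₀ 1)] with y hy
      refine ContinuousAt.mul ?_ continuousAt_const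
      have hne : ‖x₀ - y‖ ≠ 1 := by
        simpa [dist_eq_norm, norm_sub_rev] using hy
      refine ContinuousAt.comp (f := fun x => x - y)
        (g := (Metric.ball (0 : EuclideanSpace ℝ (Fin n)) 1)ᶜ.indicator k) ?_ (by fun_prop)
      rcases lt_or_gt_of_ne hne with h | h
      · have : (Metric.ball (0 : EuclideanSpace ℝ (Fin n)) 1)ᶜ.indicator k =ᶠ[𝓝 (x₀ - y)]
            fun _ => 0 := by
          filter_upwards [Metric.isOpen_ball.mem_nhds (show x₀ - y ∈ Metric.ball 0 1 by simpa)]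
            with z hz
          exact Set.indicator_of_notMem (by simpa using hz) k
        exact continuousAt_const.congr this.symm
      · have hopen : IsOpen {z : EuclideanSpace ℝ (Fin n) | 1 < ‖z‖} :=
          isOpen_lt continuous_const continuous_norm
        have : (Metric.ball (0 : EuclideanSpace ℝ (Fin n)) 1)ᶜ.indicator k =ᶠ[𝓝 (x₀ - y)] k := by
          filter_upwards [hopen.mem_nhds h] with z hz
          exact Set.indicator_of_mem (by simpa using (show 1 < ‖z‖ from hz).le) k
        refine ContinuousAt.congr ?_ this.symm
        refine hk.continuousOn.continuousAt (isOpen_compl_singleton.mem_nhds ?_)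
        exact norm_pos_iff.1 (one_pos.trans h)

/-- Differentiation under the integral sign of a convolution with a singular kernel. -/
theorem hasDerivAt_integral {k' a : EuclideanSpace ℝ (Fin n) → ℝ} (hk' : IsSingularKernel p k')
    (hp : p < n) (hn : 2 ≤ n) (hf : Continuous f) (hfi : Integrable f)
    (v : EuclideanSpace ℝ (Fin n))
    (hk : ∀ z ≠ 0, HasDerivAt (fun t : ℝ => k (z + t • v)) (k' z) 0)
    (hF : ∀ x, Integrable (fun y => (k (x - y) + a y) * f y)) (x : EuclideanSpace ℝ (Fin n)) :
    HasDerivAt (fun t : ℝ => ∫ y, (k (x + t • v - y) + a y) * f y) (∫ y, k' (x - y) * f y) 0 := by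
  have hG : Continuous (fun s : ℝ => ∫ y, k' (x + s • v - y) * f y) :=
    (hk'.continuous_integral hp hf hfi).comp (by fun_prop : Continuous fun s : ℝ => x + s • v)
  have hGabs : Continuous (fun s : ℝ => ∫ y, |k' (x + s • v - y)| * |f y|) :=
    (hk'.abs.continuous_integral hp hf.abs hfi.abs).comp
      (by fun_prop : Continuous fun s : ℝ => x + s • v)
  -- Since `n ≥ 2`, a line is a null set: for almost every `y` the whole path misses the
  -- singularity.
  have hline : ∀ᵐ y, ∀ s : ℝ, x + s • v - y ≠ 0 := by
    have hspan : Submodule.span ℝ {v} ≠ ⊤ := by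
      intro h
      have h1 := finrank_span_le_card (R := ℝ) ({v} : Set (EuclideanSpace ℝ (Fin n)))
      rw [h, finrank_top] at h1
      simp at h1
      omega
    have h0 := Measure.addHaar_submodule volume _ hspan
    have h1 : ∀ᵐ z, z ∉ Submodule.span ℝ {v} := compl_mem_ae_iff.2 h0
    have h2 := (Measure.measurePreserving_sub_left volume x).quasiMeasurePreserving.ae h1
    filter_upwards [h2] with y hy s hs
    refine hy (Submodule.mem_span_singleton.2 ⟨-s, ?_⟩)
    rw [neg_smul, eq_comm, ← sub_eq_zero, ← hs]
    abel
  -- The fundamental theorem of calculus along the line, with Fubini, writes the increment as an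
  -- integral of a continuous function of `s`. The term `a` cancels in the increment; it only serves
  -- to make the integral converge.
  have key : ∀ t : ℝ, ∫ y, (k (x + t • v - y) + a y) * f y =
      (∫ y, (k (x - y) + a y) * f y) + ∫ s in (0 : ℝ)..t, ∫ y, k' (x + s • v - y) * f y := by
    intro t
    rw [← sub_eq_iff_eq_add', ← integral_sub (hF _) (hF _)]
    rw [intervalIntegral_integral_swap]
    · refine integral_congr_ae ?_
      filter_upwards [hline] with y hy
      have hd : ∀ s : ℝ, HasDerivAt (fun s : ℝ => k (x + s • v - y)) (k' (x + s • v - y)) s := by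
        intro s
        have := (hk _ (hy s))
        have h2 : HasDerivAt (fun r : ℝ => r - s) 1 s := (hasDerivAt_id s).sub_const s
        have h3 := HasDerivAt.comp_of_eq s this h2 (sub_self s).symm
        rw [mul_one] at h3
        refine h3.congr_of_eventuallyEq (Eventually.of_forall fun r => ?_)
        simp only [Function.comp]
        congr 1
        rw [sub_smul]
        abel
      have hc : Continuous fun s : ℝ => k' (x + s • v - y) := by
        refine hk'.continuousOn.comp_continuous (by fun_prop) (fun s => hy s)
      rw [intervalIntegral.integral_mul_const, intervalIntegral.integral_eq_sub_of_hasDerivAt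
        (fun s _ => hd s) (hc.intervalIntegrable _ _)]
      simp
      ring
    · have hm : Measurable fun q : ℝ × EuclideanSpace ℝ (Fin n) => k' (x + q.1 • v - q.2) * f q.2 :=
        (hk'.measurable.comp (by fun_prop)).mul (hf.measurable.comp measurable_snd)
      refine (integrable_prod_iff hm.aestronglyMeasurable).2 ⟨ae_of_all _ fun s => ?_, ?_⟩
      · exact hk'.integrable hp hf hfi (x + s • v)
      · simp only [norm_mul, Real.norm_eq_abs]
        exact (hGabs.integrableOn_Icc (a := min 0 t) (b := max 0 t)).mono_set
          Set.Ioc_subset_Icc_self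
  have hd := intervalIntegral.integral_hasDerivAt_right (hG.intervalIntegrable 0 0)
    (hG.stronglyMeasurableAtFilter _ _) hG.continuousAt
  simp only [zero_smul, add_zero] at hd
  exact (hd.const_add _).congr_of_eventuallyEq (Eventually.of_forall key)

end IsSingularKernel

end

section

/-! ### Logarithmic potentials -/

variable {n : ℕ} {f u : EuclideanSpace ℝ (Fin n) → ℝ}

theorem isSingularKernel_norm_pow_inv (p : ℕ) :
    IsSingularKernel p (fun z : EuclideanSpace ℝ (Fin n) => (‖z‖ ^ p)⁻¹) where
  continuousOn := by
    refine ContinuousOn.inv₀ (by fun_prop) fun z hz => ?_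
    exact pow_ne_zero _ (norm_ne_zero_iff.2 hz)
  bound := ⟨1, zero_le_one, fun z _ => by rw [one_mul, abs_of_nonneg (by positivity)]⟩

/-- The derivative `∂_i` of `-log ‖z‖`. -/
def gradKernel (i : Fin n) (z : EuclideanSpace ℝ (Fin n)) : ℝ := -(z i / ‖z‖ ^ 2)

/-- The second derivative `∂_i ∂_i` of `-log ‖z‖`. -/
def hessKernel (i : Fin n) (z : EuclideanSpace ℝ (Fin n)) : ℝ :=
  -((‖z‖ ^ 2)⁻¹ - 2 * z i ^ 2 / ‖z‖ ^ 4)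

theorem abs_coord_le_norm (z : EuclideanSpace ℝ (Fin n)) (i : Fin n) : |z i| ≤ ‖z‖ :=
  PiLp.norm_apply_le z i

theorem isSingularKernel_gradKernel (i : Fin n) : IsSingularKernel 1 (gradKernel i) where
  continuousOn := by
    refine (ContinuousOn.div (by fun_prop) (by fun_prop) fun z hz => ?_).neg
    exact pow_ne_zero _ (norm_ne_zero_iff.2 hz)
  bound := by
    refine ⟨1, zero_le_one, fun z hz => ?_⟩
    have h : 0 < ‖z‖ := norm_pos_iff.2 hz
    rw [gradKernel, abs_neg, abs_div, abs_of_pos (by positivity : 0 < ‖z‖ ^ 2), pow_one, one_mul,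
      div_le_iff₀ (by positivity), pow_two, ← mul_assoc, inv_mul_cancel₀ h.ne', one_mul]
    exact abs_coord_le_norm z i

theorem isSingularKernel_gradKernel_sq (i : Fin n) :
    IsSingularKernel 2 (fun z => gradKernel i z ^ 2) where
  continuousOn := (isSingularKernel_gradKernel i).continuousOn.pow 2
  bound := by
    obtain ⟨M, hM0, hM⟩ := (isSingularKernel_gradKernel i).bound
    refine ⟨M ^ 2, by positivity, fun z hz => ?_⟩
    rw [abs_pow]
    calc |gradKernel i z| ^ 2 ≤ (M * (‖z‖ ^ 1)⁻¹) ^ 2 := by gcongr; exact hM z hz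
      _ = M ^ 2 * (‖z‖ ^ 2)⁻¹ := by rw [mul_pow, inv_pow, pow_one]

theorem isSingularKernel_hessKernel (i : Fin n) : IsSingularKernel 2 (hessKernel i) where
  continuousOn := by
    refine (ContinuousOn.sub (isSingularKernel_norm_pow_inv 2).continuousOn
      (ContinuousOn.div (by fun_prop) (by fun_prop) fun z hz => ?_)).neg
    exact pow_ne_zero _ (norm_ne_zero_iff.2 hz)
  bound := by
    refine ⟨3, by norm_num, fun z hz => ?_⟩
    have h : 0 < ‖z‖ := norm_pos_iff.2 hz
    have h1 : z i ^ 2 ≤ ‖z‖ ^ 2 := sq_le_sq' (by linarith [abs_le.1 (abs_coord_le_norm z i)])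
      (abs_le.1 (abs_coord_le_norm z i)).2
    have h2 : 2 * z i ^ 2 / ‖z‖ ^ 4 ≤ 2 * (‖z‖ ^ 2)⁻¹ := by
      rw [div_le_iff₀ (by positivity)]
      calc 2 * z i ^ 2 ≤ 2 * ‖z‖ ^ 2 := by linarith
        _ = 2 * (‖z‖ ^ 2)⁻¹ * ‖z‖ ^ 4 := by field_simp
    have h3 : 0 ≤ 2 * z i ^ 2 / ‖z‖ ^ 4 := by positivity
    have h4 : 0 ≤ (‖z‖ ^ 2)⁻¹ := by positivity
    rw [hessKernel, abs_le]
    constructor <;> linarith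

theorem hasDerivAt_norm_sq_line (z : EuclideanSpace ℝ (Fin n)) (i : Fin n) :
    HasDerivAt (fun t : ℝ => ‖z + t • EuclideanSpace.single i (1 : ℝ)‖ ^ 2) (2 * z i) 0 := by
  have h : HasDerivAt (fun t : ℝ => z + t • EuclideanSpace.single i (1 : ℝ))
      (EuclideanSpace.single i (1 : ℝ)) 0 := by
    simpa using ((hasDerivAt_id (0 : ℝ)).smul_const (EuclideanSpace.single i (1 : ℝ))).const_add z
  simpa [EuclideanSpace.inner_single_right] using h.norm_sq

theorem hasDerivAt_neg_log_norm (i : Fin n) (z : EuclideanSpace ℝ (Fin n)) (hz : z ≠ 0) :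
    HasDerivAt (fun t : ℝ => -Real.log ‖z + t • EuclideanSpace.single i (1 : ℝ)‖)
      (gradKernel i z) 0 := by
  have h : 0 < ‖z‖ := norm_pos_iff.2 hz
  have h1 := ((hasDerivAt_norm_sq_line z i).log (by simpa using hz)).const_mul (-(1 / 2 : ℝ))
  refine (h1.congr_deriv ?_).congr_of_eventuallyEq (Eventually.of_forall fun t => ?_)
  · simp only [gradKernel, zero_smul, add_zero]
    ring
  · simp only [Real.log_pow]
    push_cast
    ring

theorem hasDerivAt_gradKernel (i : Fin n) (z : EuclideanSpace ℝ (Fin n)) (hz : z ≠ 0) :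
    HasDerivAt (fun t : ℝ => gradKernel i (z + t • EuclideanSpace.single i (1 : ℝ)))
      (hessKernel i z) 0 := by
  have h : 0 < ‖z‖ := norm_pos_iff.2 hz
  have h0 : HasDerivAt (fun t : ℝ => (z + t • EuclideanSpace.single i (1 : ℝ)) i) 1 0 := by
    simpa using (hasDerivAt_id (0 : ℝ)).const_add (z i)
  have h1 := (h0.div (hasDerivAt_norm_sq_line z i) (by simpa using hz)).neg
  refine h1.congr_deriv ?_
  simp only [hessKernel, zero_smul, add_zero]
  field_simp

/-- The Laplacian and the squared gradient of the logarithm are both multiples of `‖z‖⁻²`, which is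
why `Δu` can control `|∇u|²`. -/
theorem sum_hessKernel (z : EuclideanSpace ℝ (Fin n)) (hz : z ≠ 0) :
    ∑ i, hessKernel i z = -((n - 2) * (‖z‖ ^ 2)⁻¹) := by
  have h : 0 < ‖z‖ := norm_pos_iff.2 hz
  have hs : ∑ i, z i ^ 2 = ‖z‖ ^ 2 := (EuclideanSpace.real_norm_sq_eq z).symm
  simp only [hessKernel, Finset.sum_neg_distrib, Finset.sum_sub_distrib, ← Finset.sum_div,
    ← Finset.mul_sum, hs, Finset.sum_const, Finset.card_univ, Fintype.card_fin, nsmul_eq_mul]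
  field_simp

theorem sum_gradKernel_sq (z : EuclideanSpace ℝ (Fin n)) :
    ∑ i, gradKernel i z ^ 2 = (‖z‖ ^ 2)⁻¹ := by
  have hs : ∑ i, z i ^ 2 = ‖z‖ ^ 2 := (EuclideanSpace.real_norm_sq_eq z).symm
  simp only [gradKernel, neg_sq, div_pow, ← Finset.sum_div, hs]
  by_cases h : ‖z‖ = 0
  · simp [h]
  · field_simp

/-- Apply `log s ≤ s - 1` to `a / b` and to `b / a`. With `a = ‖y‖`, `b = ‖x - y‖`, `t = ‖x‖`, two
kernels of order 1 dominate the logarithmic one. -/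
theorem abs_log_div_le {a b t : ℝ} (ha : 0 < a) (hb : 0 < b) (hab : a ≤ t + b) (hba : b ≤ t + a) :
    |Real.log (a / b)| ≤ t * ((a ^ 1)⁻¹ + (b ^ 1)⁻¹) := by
  have ht : 0 ≤ t := by linarith
  rw [pow_one, pow_one]
  have key : ∀ {a b : ℝ}, 0 < a → 0 < b → a ≤ t + b → Real.log (a / b) ≤ t * b⁻¹ := by
    intro a b ha hb hab
    refine (Real.log_le_sub_one_of_pos (div_pos ha hb)).trans ?_
    rw [sub_le_iff_le_add, div_le_iff₀ hb, add_mul, mul_assoc, inv_mul_cancel₀ hb.ne']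
    linarith
  have h1 := key ha hb hab
  have h2 := key hb ha hba
  have h3 : Real.log (b / a) = -Real.log (a / b) := by rw [← Real.log_inv, inv_div]
  have h4 : 0 ≤ t * a⁻¹ := by positivity
  have h5 : 0 ≤ t * b⁻¹ := by positivity
  rw [abs_le]
  constructor <;> linarith

theorem ae_ne_and_ne (hn : 0 < n) (x : EuclideanSpace ℝ (Fin n)) :
    ∀ᵐ y : EuclideanSpace ℝ (Fin n), y ≠ 0 ∧ x - y ≠ 0 := by
  have : Nontrivial (EuclideanSpace ℝ (Fin n)) :=
    Module.nontrivial_of_finrank_pos (R := ℝ) (by simpa)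
  filter_upwards [compl_mem_ae_iff.2 (measure_singleton (0 : EuclideanSpace ℝ (Fin n))),
    compl_mem_ae_iff.2 (measure_singleton x)] with y hy hy'
  exact ⟨hy, fun h => hy' (sub_eq_zero.1 h).symm⟩

theorem integrable_log_potential (hn : 2 ≤ n) (hf : Continuous f) (hfi : Integrable f)
    (x : EuclideanSpace ℝ (Fin n)) :
    Integrable (fun y => Real.log (‖y‖ / ‖x - y‖) * f y) := by
  have h1 := (isSingularKernel_norm_pow_inv (n := n) 1).integrable (by omega) hf.abs hfi.abs x
  have h0 := (isSingularKernel_norm_pow_inv (n := n) 1).integrable (by omega) hf.abs hfi.abs 0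
  refine ((h0.add h1).const_mul ‖x‖).mono' ?_ ?_
  · exact (((by fun_prop : Measurable fun y => ‖y‖ / ‖x - y‖).log).mul
      hf.measurable).aestronglyMeasurable
  · filter_upwards [ae_ne_and_ne (by omega) x] with y hy
    rw [norm_mul, Real.norm_eq_abs, Real.norm_eq_abs]
    have := abs_log_div_le (t := ‖x‖) (norm_pos_iff.2 hy.1) (norm_pos_iff.2 hy.2)
      (by simpa using norm_sub_le x (x - y)) (norm_sub_le x y)
    refine (mul_le_mul_of_nonneg_right this (abs_nonneg _)).trans_eq ?_
    simp only [Pi.add_apply, zero_sub, norm_neg]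
    ring

theorem log_potential_congr (hn : 0 < n) (x : EuclideanSpace ℝ (Fin n)) :
    (fun y => Real.log (‖y‖ / ‖x - y‖) * f y) =ᵐ[volume]
      fun y => (-Real.log ‖x - y‖ + Real.log ‖y‖) * f y := by
  filter_upwards [ae_ne_and_ne hn x] with y hy
  rw [Real.log_div (norm_ne_zero_iff.2 hy.1) (norm_ne_zero_iff.2 hy.2)]
  ring

theorem hasDerivAt_line (hu : Differentiable ℝ u) (i : Fin n) (x : EuclideanSpace ℝ (Fin n)) :
    HasDerivAt (fun t : ℝ => u (x + t • EuclideanSpace.single i (1 : ℝ))) (partialDeriv i u x)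
      0 := by
  have h : HasDerivAt (fun t : ℝ => x + t • EuclideanSpace.single i (1 : ℝ))
      (EuclideanSpace.single i (1 : ℝ)) 0 := by
    simpa using ((hasDerivAt_id (0 : ℝ)).smul_const (EuclideanSpace.single i (1 : ℝ))).const_add x
  exact HasFDerivAt.comp_hasDerivAt_of_eq 0 (hu x).hasFDerivAt h (by simp)

variable {c C : ℝ}

theorem partialDeriv_log_potential (hn : 2 ≤ n) (hf : Continuous f) (hfi : Integrable f)
    (hu : Differentiable ℝ u)
    (hrep : ∀ x, u x = c * (∫ y, Real.log (‖y‖ / ‖x - y‖) * f y) + C)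
    (i : Fin n) (x : EuclideanSpace ℝ (Fin n)) :
    partialDeriv i u x = c * ∫ y, gradKernel i (x - y) * f y := by
  have hrep' : ∀ x, u x = c * (∫ y, (-Real.log ‖x - y‖ + Real.log ‖y‖) * f y) + C := fun x => by
    rw [hrep, integral_congr_ae (log_potential_congr (by omega) x)]
  have h := (isSingularKernel_gradKernel i).hasDerivAt_integral
    (k := fun z => -Real.log ‖z‖) (a := fun y => Real.log ‖y‖) (by omega) hn hf hfi
    (EuclideanSpace.single i 1) (hasDerivAt_neg_log_norm i)
    (fun x => (integrable_log_potential hn hf hfi x).congr (log_potential_congr (by omega) x)) x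
  refine (hasDerivAt_line hu i x).unique ?_
  simp only [hrep']
  exact (h.const_mul c).add_const C

theorem partialDeriv_partialDeriv_log_potential (hn : 3 ≤ n) (hf : Continuous f)
    (hfi : Integrable f) (hu : ContDiff ℝ 2 u)
    (hrep : ∀ x, u x = c * (∫ y, Real.log (‖y‖ / ‖x - y‖) * f y) + C)
    (i : Fin n) (x : EuclideanSpace ℝ (Fin n)) :
    partialDeriv i (partialDeriv i u) x = c * ∫ y, hessKernel i (x - y) * f y := by
  have h := (isSingularKernel_hessKernel i).hasDerivAt_integral
    (k := gradKernel i) (a := fun _ => 0) (by omega) (by omega) hf hfi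
    (EuclideanSpace.single i 1) (hasDerivAt_gradKernel i)
    (fun x => by
      simpa using (isSingularKernel_gradKernel i).integrable (by omega) hf hfi x) x
  refine (hasDerivAt_line (partialDeriv_differentiable hu i) i x).unique ?_
  simp only [partialDeriv_log_potential (by omega) hf hfi (hu.differentiable (by norm_num)) hrep]
  simpa using h.const_mul c

theorem sum_partialDeriv_partialDeriv_log_potential (hn : 3 ≤ n) (hf : Continuous f)
    (hfi : Integrable f) (hu : ContDiff ℝ 2 u)
    (hrep : ∀ x, u x = c * (∫ y, Real.log (‖y‖ / ‖x - y‖) * f y) + C)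
    (x : EuclideanSpace ℝ (Fin n)) :
    ∑ i, partialDeriv i (partialDeriv i u) x =
      -((n - 2) * (c * ∫ y, (‖x - y‖ ^ 2)⁻¹ * f y)) := by
  simp only [partialDeriv_partialDeriv_log_potential hn hf hfi hu hrep, ← Finset.mul_sum]
  rw [← integral_finsetSum _ fun i _ =>
    (isSingularKernel_hessKernel i).integrable (by omega) hf hfi x]
  have : (fun y => ∑ i, hessKernel i (x - y) * f y) =ᵐ[volume]
      fun y => -((n - 2) * ((‖x - y‖ ^ 2)⁻¹ * f y)) := by
    filter_upwards [ae_ne_and_ne (by omega) x] with y hy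
    rw [← Finset.sum_mul, sum_hessKernel _ hy.2]
    ring
  rw [integral_congr_ae this, integral_neg, integral_const_mul]
  ring

/-- Cauchy–Schwarz for the measure `f dy`: the quadratic `t ↦ ∫ (t - w)² f` is nonnegative, so its
discriminant is not positive. -/
theorem sq_integral_mul_le {w : EuclideanSpace ℝ (Fin n) → ℝ} (hf0 : ∀ x, 0 ≤ f x)
    (hfi : Integrable f) (hw : Integrable fun y => w y * f y)
    (hw2 : Integrable fun y => w y ^ 2 * f y) :
    (∫ y, w y * f y) ^ 2 ≤ (∫ y, f y) * ∫ y, w y ^ 2 * f y := by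
  have h : ∀ t : ℝ, 0 ≤ (∫ y, f y) * (t * t) + (-2 * ∫ y, w y * f y) * t
      + ∫ y, w y ^ 2 * f y := by
    intro t
    have hi : Integrable fun y => f y * (t * t) + -2 * (w y * f y) * t :=
      (hfi.mul_const _).add ((hw.const_mul _).mul_const _)
    have : ∫ y, (t - w y) ^ 2 * f y = (∫ y, f y) * (t * t) + (-2 * ∫ y, w y * f y) * t
      + ∫ y, w y ^ 2 * f y := by
      rw [← integral_mul_const, ← integral_const_mul, ← integral_mul_const,
        ← integral_add (hfi.mul_const _) ((hw.const_mul _).mul_const _), ← integral_add hi hw2]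
      congr 1
      ext y
      ring
    rw [← this]
    exact integral_nonneg fun y => mul_nonneg (sq_nonneg _) (hf0 y)
  have := discrim_le_zero h
  rw [discrim] at this
  linarith

theorem sum_sq_integral_gradKernel_le (hn : 3 ≤ n) (hf : Continuous f) (hf0 : ∀ x, 0 ≤ f x)
    (hfi : Integrable f) (x : EuclideanSpace ℝ (Fin n)) :
    ∑ i, (∫ y, gradKernel i (x - y) * f y) ^ 2 ≤
      (∫ y, f y) * ∫ y, (‖x - y‖ ^ 2)⁻¹ * f y := by
  have hi := fun i => (isSingularKernel_gradKernel_sq i).integrable (by omega) hf hfi x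
  calc ∑ i, (∫ y, gradKernel i (x - y) * f y) ^ 2
      ≤ ∑ i, (∫ y, f y) * ∫ y, gradKernel i (x - y) ^ 2 * f y :=
        Finset.sum_le_sum fun i _ => sq_integral_mul_le hf0 hfi
          ((isSingularKernel_gradKernel i).integrable (by omega) hf hfi x) (hi i)
    _ = (∫ y, f y) * ∫ y, (‖x - y‖ ^ 2)⁻¹ * f y := by
        rw [← Finset.mul_sum, ← integral_finsetSum _ fun i _ => hi i]
        simp only [← Finset.sum_mul, sum_gradKernel_sq]

/-- The Laplacian term contributes the factor 2, and the gradient term takes away at most `c ∫ f`.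
-/
theorem le_scalarCurvature_log_potential (hn : 3 ≤ n) (hf : Continuous f) (hf0 : ∀ x, 0 ≤ f x)
    (hfi : Integrable f) (hu : ContDiff ℝ 2 u)
    (hrep : ∀ x, u x = c * (∫ y, Real.log (‖y‖ / ‖x - y‖) * f y) + C)
    (x : EuclideanSpace ℝ (Fin n)) :
    (n - 1) * (n - 2) * ((2 - c * ∫ y, f y) * (c * ∫ y, (‖x - y‖ ^ 2)⁻¹ * f y)) ≤
      scalarCurvature (conformalMetric u) x * Real.exp (2 * u x) := by
  have hn' : (3 : ℝ) ≤ n := by exact_mod_cast hn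
  have hcs := mul_le_mul_of_nonneg_left (sum_sq_integral_gradKernel_le hn hf hf0 hfi x)
    (sq_nonneg c)
  have hpos : (0 : ℝ) ≤ (n - 1) * (n - 2) := mul_nonneg (by linarith) (by linarith)
  rw [scalarCurvature_conformalMetric hu,
    sum_partialDeriv_partialDeriv_log_potential hn hf hfi hu hrep]
  simp only [partialDeriv_log_potential (by omega) hf hfi (hu.differentiable (by norm_num)) hrep,
    mul_pow, ← Finset.mul_sum]
  nlinarith [mul_le_mul_of_nonneg_left hcs hpos]

end

section

/-! ### The conformal mass of a logarithmic potential -/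

variable {n : ℕ} {f u : EuclideanSpace ℝ (Fin n) → ℝ} {c C : ℝ}

theorem unitSphereArea_pos {m : ℕ} (hm : 0 < m) : 0 < unitSphereArea m := by
  have : Nontrivial (EuclideanSpace ℝ (Fin m)) :=
    Module.nontrivial_of_finrank_pos (R := ℝ) (by simpa)
  rw [unitSphereArea, measureReal_def]
  exact ENNReal.toReal_pos (Measure.measure_univ_ne_zero.2 (Measure.toSphere_ne_zero _))
    (measure_ne_top _ _)

theorem contDiff_negLaplacianPow {u : EuclideanSpace ℝ (Fin n) → ℝ} (hu : ContDiff ℝ ∞ u) (m : ℕ) :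
    ContDiff ℝ ∞ (negLaplacianPow m u) := by
  induction m with
  | zero => simpa [negLaplacianPow] using hu
  | succ m ih =>
    have h : negLaplacianPow (m + 1) u =
        fun x => -(Laplacian.laplacian (negLaplacianPow m u) x) := by
      simp only [negLaplacianPow, Function.iterate_succ_apply']
    rw [h, InnerProductSpace.laplacian_eq_iteratedFDeriv_stdOrthonormalBasis]
    refine (ContDiff.sum fun i _ => ?_).neg
    have h2 : ContDiff ℝ ∞ (iteratedFDeriv ℝ 2 (negLaplacianPow m u)) :=
      ih.iteratedFDeriv_right (m := ∞) (i := 2) (by norm_cast)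
    exact (ContinuousMultilinearMap.apply ℝ (fun _ : Fin 2 => EuclideanSpace ℝ (Fin n)) ℝ
      ![_, _]).contDiff.comp h2

theorem continuous_partialDeriv_partialDeriv (hu : ContDiff ℝ 2 u) (i : Fin n) :
    Continuous (partialDeriv i (partialDeriv i u)) := by
  have h1 : ContDiff ℝ 1 (partialDeriv i u) :=
    (hu.fderiv_right (m := 1) (by norm_num)).clm_apply contDiff_const
  exact (h1.continuous_fderiv (by norm_num)).clm_apply continuous_const

theorem continuous_scalarCurvature_mul_exp (hu : ContDiff ℝ 2 u) :
    Continuous fun y => scalarCurvature (conformalMetric u) y * Real.exp (2 * u y) := by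
  simp only [scalarCurvature_conformalMetric hu]
  have h1 := fun i => continuous_partialDeriv_partialDeriv hu i
  have h2 := fun i => (partialDeriv_differentiable hu i).continuous
  fun_prop

theorem tendsto_sq_mul_integral (hfi : Integrable f) (x : EuclideanSpace ℝ (Fin n)) :
    Tendsto (fun r : ℝ => r ^ 2 * ∫ y, ((r + ‖x - y‖) ^ 2)⁻¹ * f y) atTop (𝓝 (∫ y, f y)) := by
  have h : Tendsto (fun r : ℝ => ∫ y, (r / (r + ‖x - y‖)) ^ 2 * f y) atTop (𝓝 (∫ y, f y)) := by
    refine tendsto_integral_filter_of_dominated_convergence (fun y => |f y|) ?_ ?_ hfi.abs ?_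
    · refine Eventually.of_forall fun r => ?_
      exact (by fun_prop : Measurable fun y => (r / (r + ‖x - y‖)) ^ 2).aestronglyMeasurable.mul
        hfi.aestronglyMeasurable
    · filter_upwards [eventually_gt_atTop 0] with r hr
      refine ae_of_all _ fun y => ?_
      rw [norm_mul, Real.norm_eq_abs, Real.norm_eq_abs, abs_of_nonneg (sq_nonneg _)]
      refine mul_le_of_le_one_left (abs_nonneg _) (pow_le_one₀ (by positivity) ?_)
      rw [div_le_one (by positivity)]
      linarith [norm_nonneg (x - y)]
    · refine ae_of_all _ fun y => ?_
      have h1 : Tendsto (fun r : ℝ => ‖x - y‖ / (r + ‖x - y‖)) atTop (𝓝 0) :=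
        tendsto_const_nhds.div_atTop (tendsto_atTop_add_const_right _ _ tendsto_id)
      have h2 : Tendsto (fun r : ℝ => r / (r + ‖x - y‖)) atTop (𝓝 1) := by
        have := h1.const_sub 1
        rw [sub_zero] at this
        refine this.congr' ?_
        filter_upwards [eventually_gt_atTop 0] with r hr
        have : r + ‖x - y‖ ≠ 0 := by positivity
        field_simp
        ring
      simpa using (h2.pow 2).mul_const (f y)
  refine h.congr fun r => ?_
  rw [← integral_const_mul]
  congr 1
  ext y
  rw [div_pow, div_eq_mul_inv, mul_assoc]

/-- The triangle inequality yields a nonsingular bound that does not depend on the direction of `z`,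
so no spherical mean has to be computed. -/
theorem integral_inv_sq_le (hn : 3 ≤ n) (hf : Continuous f) (hf0 : ∀ x, 0 ≤ f x)
    (hfi : Integrable f) (x z : EuclideanSpace ℝ (Fin n)) {r : ℝ} (hr : 0 < r) (hz : ‖z‖ ≤ r) :
    ∫ y, ((r + ‖x - y‖) ^ 2)⁻¹ * f y ≤ ∫ y, (‖x + z - y‖ ^ 2)⁻¹ * f y := by
  refine integral_mono_ae ?_ ((isSingularKernel_norm_pow_inv 2).integrable (by omega) hf hfi _) ?_
  · refine Integrable.bdd_mul (c := (r ^ 2)⁻¹) hfi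
      (by fun_prop : Measurable fun y => ((r + ‖x - y‖) ^ 2)⁻¹).aestronglyMeasurable
      (ae_of_all _ fun y => ?_)
    rw [Real.norm_eq_abs, abs_of_nonneg (by positivity)]
    gcongr
    linarith [norm_nonneg (x - y)]
  · filter_upwards [ae_ne_and_ne (by omega) (x + z)] with y hy
    refine mul_le_mul_of_nonneg_right ?_ (hf0 y)
    have h1 : 0 < ‖x + z - y‖ := norm_pos_iff.2 hy.2
    have h2 : ‖x + z - y‖ ≤ r + ‖x - y‖ := by
      calc ‖x + z - y‖ = ‖z + (x - y)‖ := by congr 1; abel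
        _ ≤ ‖z‖ + ‖x - y‖ := norm_add_le _ _
        _ ≤ r + ‖x - y‖ := by linarith
    gcongr

theorem le_sphereIntegral_scalarCurvature (hn : 3 ≤ n) (hf : Continuous f) (hf0 : ∀ x, 0 ≤ f x)
    (hfi : Integrable f) (hu : ContDiff ℝ 2 u) (hc : 0 ≤ c)
    (hrep : ∀ x, u x = c * (∫ y, Real.log (‖y‖ / ‖x - y‖) * f y) + C)
    (hα : c * ∫ y, f y ≤ 2) (x : EuclideanSpace ℝ (Fin n)) {r : ℝ} (hr : 0 < r) :
    (n - 1) * (n - 2) * (2 - c * ∫ y, f y) * c * unitSphereArea n *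
        (r ^ 2 * ∫ y, ((r + ‖x - y‖) ^ 2)⁻¹ * f y) ≤
      r ^ (3 - (n : ℤ)) * sphereIntegral
        (fun y => scalarCurvature (conformalMetric u) y * Real.exp (2 * u y)) x r := by
  have hn' : (3 : ℝ) ≤ n := by exact_mod_cast hn
  -- The area factor `r^{n-1}` and the normalisation `r^{3-n}` leave `r²`, the scale of the kernel
  -- `‖·‖⁻²`.
  have hr2 : r ^ (3 - (n : ℤ)) * r ^ (n - 1) = r ^ 2 := by
    rw [← zpow_natCast r (n - 1), ← zpow_add₀ hr.ne', ← zpow_natCast r 2]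
    congr 1
    omega
  rw [sphereIntegral, ← mul_assoc (r ^ (3 - (n : ℤ))), hr2]
  have hcont := (continuous_scalarCurvature_mul_exp hu).comp (by fun_prop : Continuous
    fun θ : Metric.sphere (0 : EuclideanSpace ℝ (Fin n)) 1 => x + r • (θ : EuclideanSpace ℝ (Fin n)))
  have hint : Integrable (fun θ : Metric.sphere (0 : EuclideanSpace ℝ (Fin n)) 1 =>
      scalarCurvature (conformalMetric u) (x + r • (θ : EuclideanSpace ℝ (Fin n))) *
        Real.exp (2 * u (x + r • (θ : EuclideanSpace ℝ (Fin n)))))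
      (volume : Measure (EuclideanSpace ℝ (Fin n))).toSphere :=
    hcont.integrable_of_hasCompactSupport (HasCompactSupport.of_compactSpace _)
  have hle := integral_mono (integrable_const ((n - 1) * (n - 2) * ((2 - c * ∫ y, f y) *
    (c * ∫ y, ((r + ‖x - y‖) ^ 2)⁻¹ * f y)))) hint fun θ => by
    refine le_trans ?_ (le_scalarCurvature_log_potential hn hf hf0 hfi hu hrep _)
    refine mul_le_mul_of_nonneg_left (mul_le_mul_of_nonneg_left (mul_le_mul_of_nonneg_left
      (integral_inv_sq_le hn hf hf0 hfi x _ hr ?_) hc) (by linarith))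
      (mul_nonneg (by linarith) (by linarith))
    rw [norm_smul, norm_eq_of_mem_sphere θ, mul_one, Real.norm_of_nonneg hr.le]
  rw [integral_const, smul_eq_mul] at hle
  refine le_trans (le_of_eq ?_) (mul_le_mul_of_nonneg_left hle (sq_nonneg r))
  rw [unitSphereArea]
  ring

theorem le_conformalMass (hn : 3 ≤ n) (hf : Continuous f) (hf0 : ∀ x, 0 ≤ f x)
    (hfi : Integrable f) (hu : ContDiff ℝ 2 u) (hc : 0 ≤ c)
    (hrep : ∀ x, u x = c * (∫ y, Real.log (‖y‖ / ‖x - y‖) * f y) + C)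
    (hα : c * ∫ y, f y ≤ 2) :
    (((2 - c * ∫ y, f y) * (c * ∫ y, f y) : ℝ) : EReal) ≤ conformalMass u := by
  have hn' : (3 : ℝ) ≤ n := by exact_mod_cast hn
  have harea := unitSphereArea_pos (m := n) (by omega)
  have h1 : (0 : ℝ) < n - 1 := by linarith
  have h2 : (0 : ℝ) < n - 2 := by linarith
  set L : ℝ := (n - 1) * (n - 2) * (2 - c * ∫ y, f y) * c * unitSphereArea n * ∫ y, f y with hL
  have hLe : (2 - c * ∫ y, f y) * (c * ∫ y, f y) =
      1 / (((n : ℝ) - 1) * ((n : ℝ) - 2) * unitSphereArea n) * L := by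
    rw [hL]
    field_simp
  rw [hLe, EReal.coe_mul, conformalMass]
  refine mul_le_mul_of_nonneg_left (le_iInf fun x => ?_) (EReal.coe_nonneg.2 (by positivity))
  -- The limit `L` does not depend on the centre `x`, so the bound survives the infimum.
  have ht := (continuous_coe_real_ereal.tendsto L).comp
    ((tendsto_sq_mul_integral hfi x).const_mul
      ((n - 1) * (n - 2) * (2 - c * ∫ y, f y) * c * unitSphereArea n))
  rw [← ht.liminf_eq]
  refine liminf_le_liminf ?_
  filter_upwards [eventually_gt_atTop 0] with r hr
  exact EReal.coe_le_coe_iff.2 (le_sphereIntegral_scalarCurvature hn hf hf0 hfi hu hc hrep hα x hr)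

theorem conformalMass_const (a : ℝ) : conformalMass (fun _ : EuclideanSpace ℝ (Fin n) => a) = 0 := by
  have h0 : ∀ i : Fin n, partialDeriv i (fun _ => a) = fun _ => 0 := fun i => by
    ext x
    simp [partialDeriv]
  have h1 : ∀ (i : Fin n) y, partialDeriv i (fun _ => 0) y = 0 := fun i y => by
    simp [partialDeriv]
  have h : ∀ y, scalarCurvature (conformalMetric fun _ : EuclideanSpace ℝ (Fin n) => a) y *
      Real.exp (2 * a) = 0 := fun y => by
    rw [scalarCurvature_conformalMetric (u := fun _ => a) contDiff_const]
    simp only [h0, h1]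
    simp
  simp only [conformalMass, h, sphereIntegral]
  simp

end

section

/-! ### The distance of a conformal metric -/

variable {n : ℕ} {u : EuclideanSpace ℝ (Fin n) → ℝ}

theorem tangentLength_conformalMetric (u : EuclideanSpace ℝ (Fin n) → ℝ)
    (x v : EuclideanSpace ℝ (Fin n)) :
    tangentLength (conformalMetric u) x v = Real.exp (u x) * ‖v‖ := by
  have h : ∑ i, ∑ j, conformalMetric u x i j * v i * v j = (Real.exp (u x) * ‖v‖) ^ 2 := by
    simp only [conformalMetric_apply, ite_mul, zero_mul, Finset.sum_ite_eq, Finset.mem_univ,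
      if_true]
    rw [mul_pow, EuclideanSpace.real_norm_sq_eq, Finset.mul_sum, ← Real.exp_nat_mul]
    exact Finset.sum_congr rfl fun i _ => by push_cast; ring
  rw [tangentLength, h, Real.sqrt_sq (by positivity)]

/-- The extended norm of `e^{2u} |dx|²` on the tangent spaces. -/
abbrev conformalENorm (u : EuclideanSpace ℝ (Fin n) → ℝ) (p : EuclideanSpace ℝ (Fin n)) :
    ENorm (TangentSpace 𝓘(ℝ, EuclideanSpace ℝ (Fin n)) p) :=
  ⟨fun v => ENNReal.ofReal (tangentLength (conformalMetric u) p v)⟩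

theorem pathELength_conformalMetric (u : EuclideanSpace ℝ (Fin n) → ℝ)
    (γ : ℝ → EuclideanSpace ℝ (Fin n)) (a b : ℝ) :
    @Manifold.pathELength _ _ _ _ _ 𝓘(ℝ, EuclideanSpace ℝ (Fin n))
      (EuclideanSpace ℝ (Fin n)) _ _ (conformalENorm u) γ a b =
      ∫⁻ t in Set.Icc a b, ENNReal.ofReal (Real.exp (u (γ t)) * ‖deriv γ t‖) := by
  rw [@Manifold.pathELength_eq_lintegral_mfderiv_Icc _ _ _ _ _ 𝓘(ℝ, EuclideanSpace ℝ (Fin n))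
      (EuclideanSpace ℝ (Fin n)) _ _ (conformalENorm u)]
  refine lintegral_congr fun t => ?_
  have h : (mfderiv 𝓘(ℝ, ℝ) 𝓘(ℝ, EuclideanSpace ℝ (Fin n)) γ t (1 : ℝ) :
      EuclideanSpace ℝ (Fin n)) = deriv γ t := by
    rw [mfderiv_eq_fderiv]
    rfl
  exact congrArg ENNReal.ofReal ((tangentLength_conformalMetric u (γ t) _).trans
    (congrArg (fun v : EuclideanSpace ℝ (Fin n) => Real.exp (u (γ t)) * ‖v‖) h))

/-- Homogeneity makes length invariant under reparametrisation, hence the distance symmetric and any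
parameter interval admissible. -/
theorem conformalENorm_smul (u : EuclideanSpace ℝ (Fin n) → ℝ) (x : EuclideanSpace ℝ (Fin n)) :
    @ENormSMulClass ℝ (TangentSpace 𝓘(ℝ, EuclideanSpace ℝ (Fin n)) x) _ (conformalENorm u x) _ := by
  have h : ∀ (r : ℝ) (v : EuclideanSpace ℝ (Fin n)),
      ENNReal.ofReal (tangentLength (conformalMetric u) x (r • v)) =
        ‖r‖ₑ * ENNReal.ofReal (tangentLength (conformalMetric u) x v) := fun r v => by
    rw [tangentLength_conformalMetric, tangentLength_conformalMetric, norm_smul,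
      ← ofReal_norm, ← ENNReal.ofReal_mul (norm_nonneg _)]
    congr 1
    ring
  exact @ENormSMulClass.mk _ _ _ (conformalENorm u x) _ h

theorem riemDist_comm (u : EuclideanSpace ℝ (Fin n) → ℝ) (p q : EuclideanSpace ℝ (Fin n)) :
    riemDist (conformalMetric u) p q = riemDist (conformalMetric u) q p := by
  let _ := conformalENorm u
  have := conformalENorm_smul u
  exact Manifold.riemannianEDist_comm

theorem riemDist_le_lintegral (u : EuclideanSpace ℝ (Fin n) → ℝ)
    {γ : ℝ → EuclideanSpace ℝ (Fin n)} {a b : ℝ} (hab : a ≤ b)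
    (hγ : ContDiffOn ℝ 1 γ (Set.Icc a b)) :
    riemDist (conformalMetric u) (γ a) (γ b) ≤
      ∫⁻ t in Set.Icc a b, ENNReal.ofReal (Real.exp (u (γ t)) * ‖deriv γ t‖) := by
  rw [← pathELength_conformalMetric]
  let _ := conformalENorm u
  have := conformalENorm_smul u
  exact Manifold.riemannianEDist_le_pathELength (contMDiffOn_iff_contDiffOn.2 hγ) rfl rfl hab

theorem exists_path_of_riemDist_lt {p q : EuclideanSpace ℝ (Fin n)} {r : ℝ≥0∞}
    (h : riemDist (conformalMetric u) p q < r) :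
    ∃ γ : ℝ → EuclideanSpace ℝ (Fin n), γ 0 = p ∧ γ 1 = q ∧ ContDiffOn ℝ 1 γ (Set.Icc 0 1) ∧
      ∫⁻ t in Set.Icc (0 : ℝ) 1, ENNReal.ofReal (Real.exp (u (γ t)) * ‖deriv γ t‖) < r := by
  let _ := conformalENorm u
  obtain ⟨γ, h0, h1, hγ, hl⟩ := Manifold.exists_lt_of_riemannianEDist_lt h
  refine ⟨γ, h0, h1, contMDiffOn_iff_contDiffOn.1 hγ, ?_⟩
  rwa [← pathELength_conformalMetric]

/-- A bound on the `g`-gradient is a Lipschitz bound: integrate `dh` along nearly shortest paths.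
This turns test functions into lower bounds for the distance. -/
theorem enorm_sub_le_mul_riemDist {h : EuclideanSpace ℝ (Fin n) → ℝ} (hh : ContDiff ℝ 1 h) {K : ℝ}
    (hK : ∀ z, ‖fderiv ℝ h z‖ ≤ K * Real.exp (u z)) (hK0 : 0 < K)
    (p q : EuclideanSpace ℝ (Fin n)) :
    ‖h q - h p‖ₑ ≤ ENNReal.ofReal K * riemDist (conformalMetric u) p q := by
  have hKK : ENNReal.ofReal K ≠ 0 := by simpa
  rw [mul_comm, ← ENNReal.div_le_iff_le_mul (Or.inl hKK) (Or.inl ENNReal.ofReal_ne_top)]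
  refine le_of_forall_gt fun r hr => ?_
  obtain ⟨γ, h0, h1, hγ, hl⟩ := exists_path_of_riemDist_lt hr
  refine lt_of_le_of_lt ?_ hl
  rw [ENNReal.div_le_iff_le_mul (Or.inl hKK) (Or.inl ENNReal.ofReal_ne_top), mul_comm,
    ← lintegral_const_mul' _ _ ENNReal.ofReal_ne_top]
  have hc : ContDiffOn ℝ 1 (h ∘ γ) (Set.Icc 0 1) := hh.comp_contDiffOn hγ
  have hle := enorm_sub_le_lintegral_deriv_of_contDiffOn_Icc hc zero_le_one
  simp only [Function.comp, h0, h1] at hle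
  refine hle.trans ?_
  -- The path is `C¹` only on the closed interval, so two-sided derivatives are available only
  -- inside.
  rw [← restrict_Ioo_eq_restrict_Icc]
  refine setLIntegral_mono' measurableSet_Ioo fun t ht => ?_
  have hd : DifferentiableAt ℝ γ t :=
    ((hγ t ⟨ht.1.le, ht.2.le⟩).differentiableWithinAt one_ne_zero).differentiableAt
      (Icc_mem_nhds ht.1 ht.2)
  have hderiv : deriv (h ∘ γ) t = fderiv ℝ h (γ t) (deriv γ t) :=
    fderiv_comp_deriv t (hh.differentiable one_ne_zero _) hd
  rw [hderiv, ← ofReal_norm, ← ENNReal.ofReal_mul hK0.le]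
  refine ENNReal.ofReal_le_ofReal ?_
  refine ((fderiv ℝ h (γ t)).le_opNorm _).trans ?_
  rw [← mul_assoc]
  exact mul_le_mul_of_nonneg_right (hK _) (norm_nonneg _)

/-- A sequence that converges for the distance of `e^{2u} |dx|²` is eventually in a Euclidean
ball. -/
theorem eventually_mem_ball_of_tendsto_riemDist (hu : Continuous u)
    {s : ℕ → EuclideanSpace ℝ (Fin n)} {x : EuclideanSpace ℝ (Fin n)}
    (hs : Tendsto (fun k => riemDist (conformalMetric u) (s k) x) atTop (𝓝 0)) :
    ∀ᶠ k in atTop, s k ∈ Metric.ball x 2 := by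
  -- The `g`-gradient of this bump is bounded by compactness of its support, so points outside the
  -- ball stay at distance at least `1 / (|K| + 1)` from `x`.
  let h : ContDiffBump x := ⟨1, 2, one_pos, one_lt_two⟩
  have hh : ContDiff ℝ 1 h := h.contDiff
  have hcont : Continuous fun z => ‖fderiv ℝ h z‖ * Real.exp (-u z) :=
    (hh.continuous_fderiv one_ne_zero).norm.mul (Real.continuous_exp.comp hu.neg)
  have hsupp : HasCompactSupport fun z => ‖fderiv ℝ h z‖ * Real.exp (-u z) :=
    (h.hasCompactSupport.fderiv (𝕜 := ℝ)).norm.mul_right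
  obtain ⟨K, hK⟩ := hcont.bounded_above_of_compact_support hsupp
  have hK' : ∀ z, ‖fderiv ℝ h z‖ ≤ (|K| + 1) * Real.exp (u z) := fun z => by
    have h1 : ‖fderiv ℝ h z‖ * Real.exp (-u z) ≤ |K| + 1 := by
      linarith [(le_abs_self _).trans (hK z), le_abs_self K]
    rw [Real.exp_neg] at h1
    exact (mul_inv_le_iff₀ (Real.exp_pos _)).1 h1
  have hlim : Tendsto (fun k => ENNReal.ofReal (|K| + 1) *
      riemDist (conformalMetric u) (s k) x) atTop (𝓝 0) := by
    simpa using ENNReal.Tendsto.const_mul hs (Or.inr ENNReal.ofReal_ne_top)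
  filter_upwards [hlim.eventually (gt_mem_nhds one_pos)] with k hk
  by_contra hmem
  have h0 : h (s k) = 0 := by
    have : s k ∉ Function.support h := by rwa [h.support_eq]
    simpa using this
  have h1 : h x = 1 := h.one_of_mem_closedBall (by simp [h])
  have := enorm_sub_le_mul_riemDist hh hK' (by positivity) (s k) x
  rw [h0, h1] at this
  simp only [sub_zero, enorm_one] at this
  exact absurd hk (not_lt.2 this)

/-- The rays from the origin have infinite length for a complete metric. -/
theorem lintegral_ray_eq_top (hu : Continuous u) (hg : IsCompleteMetric (conformalMetric u))
    {θ : EuclideanSpace ℝ (Fin n)} (hθ : ‖θ‖ = 1) (R : ℝ) :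
    ∫⁻ t in Set.Ioi R, ENNReal.ofReal (Real.exp (u (t • θ))) = ⊤ := by
  by_contra hfin
  set F : ℝ → ℝ≥0∞ := fun t => ENNReal.ofReal (Real.exp (u (t • θ))) with hF
  have hle : ∀ {a b : ℝ}, a ≤ b →
      riemDist (conformalMetric u) (a • θ) (b • θ) ≤ ∫⁻ t in Set.Icc a b, F t := by
    intro a b hab
    have hd : ∀ t : ℝ, HasDerivAt (fun t : ℝ => t • θ) θ t := fun t => by
      simpa using (hasDerivAt_id t).smul_const θ
    refine (riemDist_le_lintegral u (γ := fun t => t • θ) hab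
      (by fun_prop : ContDiff ℝ 1 fun t : ℝ => t • θ).contDiffOn).trans_eq ?_
    simp [(hd _).deriv, hθ, hF]
  have htail : Tendsto (fun N : ℕ => ∫⁻ t in Set.Ici (N : ℝ), F t) atTop (𝓝 0) := by
    have hFm : Measurable F := by fun_prop
    have hempty : ⋂ N : ℕ, Set.Ici (N : ℝ) = ∅ := by
      ext t
      obtain ⟨N, hN⟩ := exists_nat_gt t
      simp only [Set.mem_iInter, Set.mem_Ici, Set.mem_empty_iff_false, iff_false, not_forall,
        not_le]
      exact ⟨N, hN⟩
    obtain ⟨N₀, hN₀⟩ := exists_nat_gt R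
    have := tendsto_measure_iInter_atTop (μ := volume.withDensity F)
      (s := fun N : ℕ => Set.Ici (N : ℝ)) (fun N => measurableSet_Ici.nullMeasurableSet)
      (fun a b hab => Set.Ici_subset_Ici.2 (by exact_mod_cast hab)) ⟨N₀, by
        rw [withDensity_apply _ measurableSet_Ici]
        exact ((lintegral_mono_set (Set.Ici_subset_Ioi.2 hN₀)).trans_lt (lt_top_iff_ne_top.2 hfin)).ne⟩
    rw [hempty, measure_empty] at this
    refine this.congr fun N => ?_
    rw [Function.comp_apply, withDensity_apply _ measurableSet_Ici]
  -- Tails of a finite length make the points `k • θ` Cauchy; a limit would trap them in a Euclidean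
  -- ball although `‖k • θ‖ = k`.
  obtain ⟨x, hx⟩ := hg (fun k => (k : ℝ) • θ) fun ε hε => by
    obtain ⟨N, hN⟩ := (htail.eventually (gt_mem_nhds hε)).exists
    have key : ∀ k ≥ N, ∀ l ≥ k,
        riemDist (conformalMetric u) ((k : ℝ) • θ) ((l : ℝ) • θ) < ε := fun k hk l hl => by
      refine ((hle (by exact_mod_cast hl)).trans (lintegral_mono_set ?_)).trans_lt hN
      exact fun t ht => (show (N : ℝ) ≤ k by exact_mod_cast hk).trans ht.1
    refine ⟨N, fun k hk l hl => ?_⟩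
    rcases le_total k l with h | h
    · exact key k hk l h
    · rw [riemDist_comm]
      exact key l hl k h
  obtain ⟨k, hk, hk'⟩ := ((eventually_mem_ball_of_tendsto_riemDist hu hx).and
    ((tendsto_natCast_atTop_atTop (R := ℝ)).eventually_ge_atTop (‖x‖ + 2))).exists
  rw [Metric.mem_ball, dist_eq_norm] at hk
  have h1 : ‖(k : ℝ) • θ‖ = k := by simp [norm_smul, hθ]
  have h2 : ‖(k : ℝ) • θ‖ - ‖x‖ ≤ ‖(k : ℝ) • θ - x‖ := norm_sub_norm_le _ _
  linarith

end

section

/-! ### Completeness bounds the total Q-curvature -/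

variable {n : ℕ} {f u : EuclideanSpace ℝ (Fin n) → ℝ} {c C R : ℝ}

/-- Integration in polar coordinates. -/
theorem lintegral_eq_lintegral_toSphere (hn : 0 < n) {G : EuclideanSpace ℝ (Fin n) → ℝ≥0∞}
    (hG : Measurable G) :
    ∫⁻ x, G x = ∫⁻ θ : Metric.sphere (0 : EuclideanSpace ℝ (Fin n)) 1,
      (∫⁻ r in Set.Ioi (0 : ℝ), ENNReal.ofReal (r ^ (n - 1)) *
        G (r • (θ : EuclideanSpace ℝ (Fin n))))
      ∂(volume : Measure (EuclideanSpace ℝ (Fin n))).toSphere := by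
  have : Nontrivial (EuclideanSpace ℝ (Fin n)) :=
    Module.nontrivial_of_finrank_pos (R := ℝ) (by simpa)
  have hmp := (volume : Measure (EuclideanSpace ℝ (Fin n))).measurePreserving_homeomorphUnitSphereProd
  have hm : Measurable fun q : Metric.sphere (0 : EuclideanSpace ℝ (Fin n)) 1 × Set.Ioi (0 : ℝ) =>
      G ((q.2 : ℝ) • (q.1 : EuclideanSpace ℝ (Fin n))) := hG.comp (by fun_prop)
  calc ∫⁻ x, G x = ∫⁻ x in {0}ᶜ, G x := by rw [restrict_compl_singleton]
    _ = ∫⁻ x : ({0}ᶜ : Set (EuclideanSpace ℝ (Fin n))), G x ∂(volume.comap Subtype.val) :=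
        (lintegral_subtype_comap (measurableSet_singleton _).compl G).symm
    _ = ∫⁻ q, G ((q.2 : ℝ) • (q.1 : EuclideanSpace ℝ (Fin n)))
          ∂((volume : Measure (EuclideanSpace ℝ (Fin n))).toSphere.prod
            (Measure.volumeIoiPow (n - 1))) := by
        rw [finrank_euclideanSpace, Fintype.card_fin] at hmp
        rw [← hmp.lintegral_comp hm]
        refine lintegral_congr fun x => ?_
        have hx : ‖(x : EuclideanSpace ℝ (Fin n))‖ ≠ 0 := norm_ne_zero_iff.2 x.2
        simp [smul_smul, hx]
    _ = _ := by
        rw [lintegral_prod _ hm.aemeasurable]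
        refine lintegral_congr fun θ => ?_
        have hm1 : Measurable fun r : ℝ => G (r • (θ : EuclideanSpace ℝ (Fin n))) :=
          hG.comp (by fun_prop)
        refine (lintegral_withDensity_eq_lintegral_mul _ (by fun_prop)
          (hm1.comp measurable_subtype_coe)).trans ?_
        exact lintegral_subtype_comap measurableSet_Ioi
          fun r : ℝ => ENNReal.ofReal (r ^ (n - 1)) * G (r • (θ : EuclideanSpace ℝ (Fin n)))

/-- The weight cancels the polar Jacobian, so this integrates the lengths of the rays over all
directions. -/
theorem lintegral_exp_eq_top (hn : 0 < n) (hu : Continuous u)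
    (hg : IsCompleteMetric (conformalMetric u)) (hR : 0 ≤ R) :
    ∫⁻ x in {x : EuclideanSpace ℝ (Fin n) | R < ‖x‖},
      ENNReal.ofReal (Real.exp (u x) * (‖x‖ ^ (n - 1))⁻¹) = ⊤ := by
  have : Nontrivial (EuclideanSpace ℝ (Fin n)) :=
    Module.nontrivial_of_finrank_pos (R := ℝ) (by simpa)
  have hs : MeasurableSet {x : EuclideanSpace ℝ (Fin n) | R < ‖x‖} :=
    measurableSet_lt measurable_const measurable_norm
  have hm : Measurable fun x => ENNReal.ofReal (Real.exp (u x) * (‖x‖ ^ (n - 1))⁻¹) := by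
    have := hu.measurable
    fun_prop
  rw [← lintegral_indicator hs, lintegral_eq_lintegral_toSphere hn (hm.indicator hs)]
  have : ∀ θ : Metric.sphere (0 : EuclideanSpace ℝ (Fin n)) 1,
      ∫⁻ r in Set.Ioi (0 : ℝ), ENNReal.ofReal (r ^ (n - 1)) *
        {x : EuclideanSpace ℝ (Fin n) | R < ‖x‖}.indicator
          (fun x => ENNReal.ofReal (Real.exp (u x) * (‖x‖ ^ (n - 1))⁻¹))
          (r • (θ : EuclideanSpace ℝ (Fin n))) = ⊤ := fun θ => by
    have hθ : ‖(θ : EuclideanSpace ℝ (Fin n))‖ = 1 := norm_eq_of_mem_sphere θ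
    rw [← top_le_iff, ← lintegral_ray_eq_top hu hg hθ R]
    refine (setLIntegral_mono' measurableSet_Ioi fun r hr => ?_).trans
      (lintegral_mono_set (Set.Ioi_subset_Ioi hR))
    have hr0 : 0 < r := hR.trans_lt hr
    have hnr : ‖r • (θ : EuclideanSpace ℝ (Fin n))‖ = r := by
      rw [norm_smul, hθ, mul_one, Real.norm_of_nonneg hr0.le]
    rw [Set.indicator_of_mem (by simpa [hnr] using hr), ← ENNReal.ofReal_mul (by positivity), hnr]
    refine (ENNReal.ofReal_le_ofReal (le_of_eq ?_))
    field_simp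
  simp only [this, lintegral_const]
  exact ENNReal.top_mul (Measure.measure_univ_ne_zero.2 (Measure.toSphere_ne_zero _))

/-- A form of Jensen's inequality for the exponential and a measure of mass at most one. -/
theorem exp_integral_mul_le {Ω : Type*} [MeasurableSpace Ω] {μ : Measure Ω} {ψ w : Ω → ℝ}
    (hw0 : ∀ y, 0 ≤ w y) (hw : Integrable w μ) (hw1 : ∫ y, w y ∂μ ≤ 1)
    (hψ : Integrable (fun y => ψ y * w y) μ) (he : Integrable (fun y => Real.exp (ψ y) * w y) μ) :
    Real.exp (∫ y, ψ y * w y ∂μ) ≤ 1 + ∫ y, Real.exp (ψ y) * w y ∂μ := by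
  set I := ∫ y, ψ y * w y ∂μ with hI
  set m := ∫ y, w y ∂μ with hm
  have hm0 : 0 ≤ m := integral_nonneg hw0
  have htan : ∀ s : ℝ, Real.exp I * (1 + s - I) ≤ Real.exp s := fun s => by
    have h1 := mul_le_mul_of_nonneg_left (Real.add_one_le_exp (s - I)) (Real.exp_pos I).le
    rw [← Real.exp_add, add_sub_cancel] at h1
    linarith
  have h1 : Real.exp I * (I + (1 - I) * m) ≤ ∫ y, Real.exp (ψ y) * w y ∂μ := by
    have hint : Integrable (fun y => ψ y * w y + (1 - I) * w y) μ := hψ.add (hw.const_mul _)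
    rw [hI, hm, ← integral_const_mul (1 - _), ← integral_add hψ (hw.const_mul _),
      ← integral_const_mul]
    refine integral_mono (hint.const_mul _) he fun y => ?_
    have := mul_le_mul_of_nonneg_right (htan (ψ y)) (hw0 y)
    simp only [← hI]
    linarith
  -- The missing mass `1 - m` is placed at the value 0, where `exp` is 1; this accounts for the
  -- extra 1.
  have h2 := mul_le_mul_of_nonneg_left (htan 0) (sub_nonneg.2 hw1)
  rw [Real.exp_zero] at h2
  nlinarith

/-- The kernel `‖z‖⁻¹` truncated to the unit ball. -/
def nearKernel (z : EuclideanSpace ℝ (Fin n)) : ℝ :=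
  (Metric.ball 0 1).indicator (fun z => (‖z‖ ^ 1)⁻¹) z

theorem nearKernel_nonneg (z : EuclideanSpace ℝ (Fin n)) : 0 ≤ nearKernel z :=
  Set.indicator_nonneg (fun _ _ => by positivity) z

theorem integrable_nearKernel (hn : 2 ≤ n) :
    Integrable (nearKernel : EuclideanSpace ℝ (Fin n) → ℝ) :=
  (integrableOn_norm_pow_inv (by omega)).integrable_indicator measurableSet_ball

theorem integrable_nearKernel_mul (hn : 2 ≤ n) (hf : Continuous f)
    (x : EuclideanSpace ℝ (Fin n)) : Integrable fun y => nearKernel (x - y) * f y :=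
  (isSingularKernel_norm_pow_inv 1).integrable_near' (by omega) hf x

/-- A convolution of two `L¹` functions: the local singularities have finite total effect. -/
theorem integrable_integral_nearKernel (hn : 2 ≤ n) (hfi : Integrable f) :
    Integrable fun x => ∫ y, nearKernel (x - y) * f y := by
  have := hfi.integrable_convolution (ContinuousLinearMap.mul ℝ ℝ) (integrable_nearKernel hn)
  refine this.congr (ae_of_all _ fun x => ?_)
  simp [convolution, mul_comm]

theorem exp_posLog_le (z : EuclideanSpace ℝ (Fin n)) :
    Real.exp (Real.posLog ‖z‖⁻¹) ≤ 1 + nearKernel z := by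
  change Real.exp (max 0 (Real.log ‖z‖⁻¹)) ≤ _
  rcases le_total (Real.log ‖z‖⁻¹) 0 with h | h
  · rw [max_eq_left h, Real.exp_zero]
    linarith [nearKernel_nonneg z]
  · rw [max_eq_right h]
    rcases eq_or_ne z 0 with rfl | hz
    · simpa using nearKernel_nonneg _
    have hz0 := norm_pos_iff.2 hz
    rw [Real.exp_log (by positivity), nearKernel]
    by_cases h1 : ‖z‖ < 1
    · rw [Set.indicator_of_mem (by simpa using h1), pow_one]
      linarith
    · rw [Set.indicator_of_notMem (by simpa using h1), add_zero]
      exact inv_le_one_of_one_le₀ (not_lt.1 h1)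

theorem posLog_inv_norm_le (z : EuclideanSpace ℝ (Fin n)) : Real.posLog ‖z‖⁻¹ ≤ nearKernel z := by
  linarith [exp_posLog_le z, Real.add_one_le_exp (Real.posLog ‖z‖⁻¹)]

/-- For `‖y‖ ≤ R` and `‖x‖ > 2R` one has `‖x - y‖ ≥ ‖x‖ / 2`. This part of the mass produces the
decay of `u`. -/
theorem setIntegral_log_near_le (hn : 2 ≤ n) (hf : Continuous f) (hf0 : ∀ x, 0 ≤ f x)
    (hfi : Integrable f) (hR : 0 < R) {x : EuclideanSpace ℝ (Fin n)} (hx : 2 * R < ‖x‖) :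
    ∫ y in {y : EuclideanSpace ℝ (Fin n) | R < ‖y‖}ᶜ, Real.log (‖y‖ / ‖x - y‖) * f y ≤
      Real.log (2 * R / ‖x‖) * ∫ y in {y : EuclideanSpace ℝ (Fin n) | R < ‖y‖}ᶜ, f y := by
  have hs : MeasurableSet {x : EuclideanSpace ℝ (Fin n) | R < ‖x‖} :=
    measurableSet_lt measurable_const measurable_norm
  rw [← integral_const_mul]
  refine setIntegral_mono_on_ae (integrable_log_potential hn hf hfi x).integrableOn
    (hfi.const_mul _).integrableOn hs.compl ?_
  filter_upwards [ae_ne_and_ne (by omega) x] with y hy hyR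
  have hyR' : ‖y‖ ≤ R := by simpa using hyR
  have h0 : 0 < ‖y‖ := norm_pos_iff.2 hy.1
  have h1 : 0 < ‖x - y‖ := norm_pos_iff.2 hy.2
  have h2 : ‖x‖ - ‖y‖ ≤ ‖x - y‖ := norm_sub_norm_le x y
  refine mul_le_mul_of_nonneg_right (Real.log_le_log (by positivity) ?_) (hf0 y)
  rw [div_le_div_iff₀ h1 (by linarith)]
  nlinarith

theorem log_div_norm_le {x y : EuclideanSpace ℝ (Fin n)} (hx : 1 ≤ ‖x‖) (hy : y ≠ 0)
    (hxy : x - y ≠ 0) :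
    Real.log (‖y‖ / ‖x - y‖) ≤ Real.log (2 * ‖x‖) + Real.posLog ‖x - y‖⁻¹ := by
  have h0 : 0 < ‖y‖ := norm_pos_iff.2 hy
  have h1 : 0 < ‖x - y‖ := norm_pos_iff.2 hxy
  have h2 : ‖y‖ ≤ ‖x‖ + ‖x - y‖ := by simpa using norm_sub_le x (x - y)
  have hE1 : 1 ≤ Real.exp (Real.posLog ‖x - y‖⁻¹) := Real.one_le_exp Real.posLog_nonneg
  have hE2 : ‖x - y‖⁻¹ ≤ Real.exp (Real.posLog ‖x - y‖⁻¹) :=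
    (Real.log_le_iff_le_exp (by positivity)).1 (le_max_right _ _)
  rw [Real.log_le_iff_le_exp (by positivity), Real.exp_add, Real.exp_log (by linarith)]
  calc ‖y‖ / ‖x - y‖ ≤ (‖x‖ + ‖x - y‖) / ‖x - y‖ := by gcongr
    _ = ‖x‖ * ‖x - y‖⁻¹ + 1 * 1 := by field_simp
    _ ≤ ‖x‖ * Real.exp (Real.posLog ‖x - y‖⁻¹) + ‖x‖ * Real.exp (Real.posLog ‖x - y‖⁻¹) := by
        gcongr
    _ = _ := by ring

theorem integrable_posLog_mul (hn : 2 ≤ n) (hf : Continuous f) (hf0 : ∀ x, 0 ≤ f x)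
    (x : EuclideanSpace ℝ (Fin n)) : Integrable fun y => Real.posLog ‖x - y‖⁻¹ * f y := by
  refine (integrable_nearKernel_mul hn hf x).mono' ?_ (ae_of_all _ fun y => ?_)
  · exact (((Real.measurable_log.const_sup 0).comp
      (by fun_prop : Measurable fun y => ‖x - y‖⁻¹)).mul hf.measurable).aestronglyMeasurable
  · rw [Real.norm_of_nonneg (mul_nonneg Real.posLog_nonneg (hf0 y))]
    exact mul_le_mul_of_nonneg_right (posLog_inv_norm_le _) (hf0 y)

theorem integrable_exp_posLog_mul (hn : 2 ≤ n) (hf : Continuous f) (hf0 : ∀ x, 0 ≤ f x)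
    (hfi : Integrable f) (x : EuclideanSpace ℝ (Fin n)) :
    Integrable fun y => Real.exp (Real.posLog ‖x - y‖⁻¹) * f y := by
  refine (hfi.add (integrable_nearKernel_mul hn hf x)).mono' ?_ (ae_of_all _ fun y => ?_)
  · exact ((((Real.measurable_log.const_sup 0).comp
      (by fun_prop : Measurable fun y => ‖x - y‖⁻¹)).exp).mul hf.measurable).aestronglyMeasurable
  · rw [Real.norm_of_nonneg (mul_nonneg (Real.exp_nonneg _) (hf0 y))]
    refine (mul_le_mul_of_nonneg_right (exp_posLog_le _) (hf0 y)).trans_eq ?_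
    simp only [Pi.add_apply]
    ring

theorem setIntegral_log_far_le (hn : 2 ≤ n) (hf : Continuous f) (hf0 : ∀ x, 0 ≤ f x)
    (hfi : Integrable f) {x : EuclideanSpace ℝ (Fin n)} (hx : 1 ≤ ‖x‖)
    (s : Set (EuclideanSpace ℝ (Fin n))) :
    ∫ y in s, Real.log (‖y‖ / ‖x - y‖) * f y ≤
      Real.log (2 * ‖x‖) * (∫ y in s, f y) + ∫ y in s, Real.posLog ‖x - y‖⁻¹ * f y := by
  have hp := integrable_posLog_mul hn hf hf0 x
  rw [← integral_const_mul, ← integral_add (hfi.const_mul _).integrableOn hp.integrableOn]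
  refine setIntegral_mono_ae (integrable_log_potential hn hf hfi x).integrableOn
    ((hfi.const_mul _).add hp).integrableOn ?_
  filter_upwards [ae_ne_and_ne (by omega) x] with y hy
  rw [← add_mul]
  exact mul_le_mul_of_nonneg_right (log_div_norm_le hx hy.1 hy.2) (hf0 y)

/-- Jensen for the measure `c f` on `s`. Mass at most one keeps the exponentiated singularity of
order `‖z‖⁻¹`, which is locally integrable. -/
theorem exp_setIntegral_posLog_le (hn : 2 ≤ n) (hf : Continuous f) (hf0 : ∀ x, 0 ≤ f x)
    (hfi : Integrable f) (hc : 0 ≤ c) (s : Set (EuclideanSpace ℝ (Fin n)))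
    (hs : c * ∫ y in s, f y ≤ 1) (x : EuclideanSpace ℝ (Fin n)) :
    Real.exp (c * ∫ y in s, Real.posLog ‖x - y‖⁻¹ * f y) ≤
      1 + c * ((∫ y, f y) + ∫ y, nearKernel (x - y) * f y) := by
  have hp := integrable_posLog_mul hn hf hf0 x
  have he := integrable_exp_posLog_mul hn hf hf0 hfi x
  have hk := integrable_nearKernel_mul hn hf x
  have hcomm : ∀ φ : EuclideanSpace ℝ (Fin n) → ℝ,
      (fun y => φ y * (c * f y)) = fun y => c * (φ y * f y) := fun φ => by
    ext y
    ring
  have h := exp_integral_mul_le (μ := volume.restrict s) (ψ := fun y => Real.posLog ‖x - y‖⁻¹)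
    (w := fun y => c * f y) (fun y => mul_nonneg hc (hf0 y)) (hfi.const_mul c).integrableOn
    (by rwa [integral_const_mul])
    (by rw [hcomm]; exact (hp.const_mul c).integrableOn)
    (by rw [hcomm fun y => Real.exp (Real.posLog ‖x - y‖⁻¹)]; exact (he.const_mul c).integrableOn)
  rw [hcomm, hcomm fun y => Real.exp (Real.posLog ‖x - y‖⁻¹), integral_const_mul,
    integral_const_mul] at h
  refine h.trans ?_
  gcongr
  rw [← integral_add hfi hk]
  refine (setIntegral_le_integral he (ae_of_all _ fun y =>
    mul_nonneg (Real.exp_nonneg _) (hf0 y))).trans ?_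
  refine integral_mono he (hfi.add hk) fun y => ?_
  refine (mul_le_mul_of_nonneg_right (exp_posLog_le _) (hf0 y)).trans_eq ?_
  ring

theorem exists_setIntegral_norm_gt_le (hfi : Integrable f) {ε : ℝ} (hε : 0 < ε) :
    ∃ R : ℝ, 1 ≤ R ∧ ∫ y in {y : EuclideanSpace ℝ (Fin n) | R < ‖y‖}, f y ≤ ε := by
  have hs : ∀ N : ℕ, MeasurableSet {x : EuclideanSpace ℝ (Fin n) | (N : ℝ) < ‖x‖} := fun N =>
    measurableSet_lt measurable_const measurable_norm
  have h := tendsto_setIntegral_of_antitone (μ := volume) (f := f) hs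
    (fun a b hab x (hx : (b : ℝ) < ‖x‖) =>
      show (a : ℝ) < ‖x‖ from (Nat.cast_le.2 hab).trans_lt hx) ⟨0, hfi.integrableOn⟩
  have hempty : ⋂ N : ℕ, {x : EuclideanSpace ℝ (Fin n) | (N : ℝ) < ‖x‖} = ∅ := by
    ext x
    obtain ⟨N, hN⟩ := exists_nat_gt ‖x‖
    simp only [Set.mem_iInter, Set.mem_ofPred_eq, Set.mem_empty_iff_false, iff_false, not_forall,
      not_lt]
    exact ⟨N, hN.le⟩
  rw [hempty, setIntegral_empty] at h
  obtain ⟨N, hN, hN1⟩ := ((h.eventually (gt_mem_nhds hε)).and (eventually_ge_atTop 1)).exists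
  exact ⟨N, by exact_mod_cast hN1, hN.le⟩

/-- The far mass is at most `1/4`, so the near mass is at least `7/4`. They contribute `+1/4` and
`-7/4` times `log ‖x‖`, hence the exponent `-3/2`, below the threshold `-1` for radial
integrability. -/
theorem log_potential_le (hn : 2 ≤ n) (hf : Continuous f) (hf0 : ∀ x, 0 ≤ f x)
    (hfi : Integrable f) (hc : 0 ≤ c)
    (hrep : ∀ x, u x = c * (∫ y, Real.log (‖y‖ / ‖x - y‖) * f y) + C)
    (hα : 2 ≤ c * ∫ y, f y) (hR : 1 ≤ R)
    (hfar : c * ∫ y in {y : EuclideanSpace ℝ (Fin n) | R < ‖y‖}, f y ≤ 1 / 4)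
    {x : EuclideanSpace ℝ (Fin n)} (hx : 2 * R < ‖x‖) :
    u x ≤ C + 7 / 4 * Real.log (2 * R) + 1 / 4 * Real.log 2 - 3 / 2 * Real.log ‖x‖ +
      c * ∫ y in {y : EuclideanSpace ℝ (Fin n) | R < ‖y‖}, Real.posLog ‖x - y‖⁻¹ * f y := by
  have hs : MeasurableSet {x : EuclideanSpace ℝ (Fin n) | R < ‖x‖} :=
    measurableSet_lt measurable_const measurable_norm
  have hx1 : 1 < ‖x‖ := by linarith
  have h1 := mul_le_mul_of_nonneg_left
    (setIntegral_log_near_le hn hf hf0 hfi (by linarith) hx) hc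
  have h2 := mul_le_mul_of_nonneg_left (setIntegral_log_far_le hn hf hf0 hfi hx1.le
    {y : EuclideanSpace ℝ (Fin n) | R < ‖y‖}) hc
  have h3 := integral_add_compl hs (integrable_log_potential hn hf hfi x)
  have h4 := integral_add_compl hs hfi
  rw [hrep x, ← h3]
  rw [← h4] at hα
  rw [Real.log_div (by linarith) (by linarith)] at h1
  rw [Real.log_mul (by norm_num) (by linarith)] at h2
  have h5 : Real.log (2 * R) ≤ Real.log ‖x‖ := Real.log_le_log (by linarith) hx.le
  have h6 : 0 ≤ Real.log ‖x‖ := Real.log_nonneg hx1.le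
  have h7 : 0 ≤ Real.log 2 := Real.log_nonneg one_le_two
  set A := ∫ y in {y : EuclideanSpace ℝ (Fin n) | R < ‖y‖}, f y
  set B := ∫ y in {y : EuclideanSpace ℝ (Fin n) | R < ‖y‖}ᶜ, f y
  have h8 : 0 ≤ (c * B - 7 / 4) * (Real.log ‖x‖ - Real.log (2 * R)) :=
    mul_nonneg (by linarith) (by linarith)
  have h9 : 0 ≤ (1 / 4 - c * A) * (Real.log 2 + Real.log ‖x‖) :=
    mul_nonneg (by linarith) (by linarith)
  linarith

theorem integrableOn_norm_rpow_div (hn : 0 < n) (hR : 0 < R) :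
    IntegrableOn (fun x : EuclideanSpace ℝ (Fin n) =>
      ‖x‖ ^ (-(3 / 2) : ℝ) * (‖x‖ ^ (n - 1))⁻¹) {x | R < ‖x‖} := by
  have : Nontrivial (EuclideanSpace ℝ (Fin n)) :=
    Module.nontrivial_of_finrank_pos (R := ℝ) (by simpa)
  have hs : MeasurableSet {x : EuclideanSpace ℝ (Fin n) | R < ‖x‖} :=
    measurableSet_lt measurable_const measurable_norm
  rw [← integrable_indicator_iff hs]
  have h := (integrable_fun_norm_addHaar (volume : Measure (EuclideanSpace ℝ (Fin n)))
    (f := (Set.Ioi R).indicator fun r : ℝ => r ^ (-(3 / 2) : ℝ) * (r ^ (n - 1))⁻¹)).2 ?_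
  · refine h.congr (ae_of_all _ fun x => ?_)
    simp [Set.indicator]
  · have h1 : IntegrableOn (fun r : ℝ => r ^ (-(3 / 2) : ℝ)) (Set.Ioi R) :=
      integrableOn_Ioi_rpow_of_lt (by norm_num) hR
    refine ((h1.integrable_indicator measurableSet_Ioi).congr (ae_of_all _ fun r => ?_)).integrableOn
    simp only [finrank_euclideanSpace, Fintype.card_fin, smul_eq_mul, Set.indicator]
    split_ifs with hr
    · have : r ≠ 0 := (hR.trans hr).ne'
      field_simp
    · simp

theorem lintegral_exp_log_potential_lt_top (hn : 2 ≤ n) (hf : Continuous f)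
    (hf0 : ∀ x, 0 ≤ f x) (hfi : Integrable f) (hc : 0 ≤ c)
    (hrep : ∀ x, u x = c * (∫ y, Real.log (‖y‖ / ‖x - y‖) * f y) + C)
    (hα : 2 ≤ c * ∫ y, f y) (hR : 1 ≤ R)
    (hfar : c * ∫ y in {y : EuclideanSpace ℝ (Fin n) | R < ‖y‖}, f y ≤ 1 / 4) :
    ∫⁻ x in {x : EuclideanSpace ℝ (Fin n) | 2 * R < ‖x‖},
      ENNReal.ofReal (Real.exp (u x) * (‖x‖ ^ (n - 1))⁻¹) < ⊤ := by
  have hs : MeasurableSet {x : EuclideanSpace ℝ (Fin n) | 2 * R < ‖x‖} :=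
    measurableSet_lt measurable_const measurable_norm
  set K := Real.exp (C + 7 / 4 * Real.log (2 * R) + 1 / 4 * Real.log 2)
  set A := 1 + c * ∫ y, f y
  have hint : IntegrableOn (fun x => K * (A * (‖x‖ ^ (-(3 / 2) : ℝ) * (‖x‖ ^ (n - 1))⁻¹)
      + c * ∫ y, nearKernel (x - y) * f y)) {x : EuclideanSpace ℝ (Fin n) | 2 * R < ‖x‖} :=
    (((integrableOn_norm_rpow_div (by omega) (by linarith)).const_mul A).add
      ((integrable_integral_nearKernel hn hfi).const_mul c).integrableOn).const_mul K
  refine lt_of_le_of_lt (setLIntegral_mono' hs fun x hx => ENNReal.ofReal_le_ofReal ?_)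
    hint.lintegral_lt_top
  have hx' : 2 * R < ‖x‖ := hx
  have hx0 : 0 < ‖x‖ := by linarith
  set H := ∫ y, nearKernel (x - y) * f y with hH
  have hH0 : 0 ≤ H := integral_nonneg fun y => mul_nonneg (nearKernel_nonneg _) (hf0 y)
  have h1 := Real.exp_le_exp.2 (log_potential_le hn hf hf0 hfi hc hrep hα hR hfar hx')
  rw [Real.exp_add, Real.exp_sub] at h1
  have h2 : Real.exp (3 / 2 * Real.log ‖x‖) = (‖x‖ ^ (-(3 / 2) : ℝ))⁻¹ := by
    rw [Real.rpow_def_of_pos hx0, ← Real.exp_neg]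
    congr 1
    ring
  have h3 := exp_setIntegral_posLog_le hn hf hf0 hfi hc _ (hfar.trans (by norm_num)) x
  rw [h2, div_inv_eq_mul] at h1
  -- The convolution term is already integrable, so its weight can simply be bounded by 1.
  have hw1 : ‖x‖ ^ (-(3 / 2) : ℝ) * (‖x‖ ^ (n - 1))⁻¹ ≤ 1 :=
    mul_le_one₀ (Real.rpow_le_one_of_one_le_of_nonpos (by linarith) (by norm_num))
      (by positivity) (inv_le_one_of_one_le₀ (one_le_pow₀ (by linarith)))
  have hK : 0 < K := Real.exp_pos _
  set W := ‖x‖ ^ (-(3 / 2) : ℝ) with hW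
  have hW0 : 0 ≤ W := by positivity
  set V := (‖x‖ ^ (n - 1))⁻¹ with hV
  have hV0 : 0 ≤ V := by positivity
  calc Real.exp (u x) * V ≤ (K * W * (1 + c * ((∫ y, f y) + H))) * V := by
        gcongr
        exact h1.trans (by gcongr)
    _ = K * (A * (W * V) + (W * V) * (c * H)) := by ring
    _ ≤ K * (A * (W * V) + 1 * (c * H)) := by gcongr
    _ = K * (A * (W * V) + c * H) := by rw [one_mul]

/-- The total curvature of a complete normal metric is bounded. -/
theorem mul_integral_lt_two (hn : 2 ≤ n) (hf : Continuous f) (hf0 : ∀ x, 0 ≤ f x)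
    (hfi : Integrable f) (hc : 0 < c) (hu : Continuous u)
    (hg : IsCompleteMetric (conformalMetric u))
    (hrep : ∀ x, u x = c * (∫ y, Real.log (‖y‖ / ‖x - y‖) * f y) + C) :
    c * ∫ y, f y < 2 := by
  by_contra hα
  -- The tolerance `1 / (4c)` makes the far part of `c ∫ f` at most `1/4`.
  obtain ⟨R, hR, hfar⟩ := exists_setIntegral_norm_gt_le hfi
    (by positivity : 0 < 1 / (4 * c))
  refine (lintegral_exp_log_potential_lt_top hn hf hf0 hfi hc.le hrep (not_lt.1 hα) hR ?_).ne
    (lintegral_exp_eq_top (by omega) hu hg (by linarith))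
  calc _ ≤ c * (1 / (4 * c)) := mul_le_mul_of_nonneg_left hfar hc.le
    _ = 1 / 4 := by field_simp

end

/-! ### Nonnegativity and rigidity of the mass -/

theorem qCurvature_mul_exp {n : ℕ} (u : EuclideanSpace ℝ (Fin n) → ℝ)
    (y : EuclideanSpace ℝ (Fin n)) :
    qCurvature u y * Real.exp (n * u y) =
      negLaplacianPow (n / 2) u y := by
  rw [qCurvature, mul_right_comm, ← Real.exp_add]
  simp

end ConformalMass

end

theorem mainTheorem9 (n : ℕ) (hn : 4 ≤ n) (hn_even : Even n)
    (u : EuclideanSpace ℝ (Fin n) → ℝ) (hu : ContDiff ℝ ∞ u)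
    (h_complete : ConformalMass.IsCompleteMetric (ConformalMass.conformalMetric u))
    (h_finite : ConformalMass.HasFiniteTotalQ u)
    (h_normal : ConformalMass.IsNormal u)
    (hQ : ∀ x, 0 ≤ ConformalMass.qCurvature u x) :
    0 ≤ ConformalMass.conformalMass u ∧
      (ConformalMass.conformalMass u = 0 ↔ ∃ c : ℝ, ∀ x, u x = c) := by
  obtain ⟨C, hrep⟩ := h_normal
  set f := ConformalMass.negLaplacianPow (n / 2) u with hf_def
  set c : ℝ := 2 / ((Nat.factorial (n - 1) : ℝ) * ConformalMass.unitSphereArea (n + 1))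
  have hc : 0 < c := by
    have := ConformalMass.unitSphereArea_pos n.succ_pos
    have := Nat.factorial_pos (n - 1)
    positivity
  have hf : Continuous f := (ConformalMass.contDiff_negLaplacianPow hu _).continuous
  have hf0 : ∀ x, 0 ≤ f x := fun x => by
    rw [hf_def, ← ConformalMass.qCurvature_mul_exp]
    exact mul_nonneg (hQ x) (Real.exp_nonneg _)
  have hfi : Integrable f := by
    simpa only [ConformalMass.HasFiniteTotalQ, ConformalMass.qCurvature_mul_exp] using h_finite
  simp only [ConformalMass.qCurvature_mul_exp] at hrep
  have hlt : c * ∫ y, f y < 2 := ConformalMass.mul_integral_lt_two (by omega) hf hf0 hfi hc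
    hu.continuous h_complete hrep
  have hmass := ConformalMass.le_conformalMass (by omega) hf hf0 hfi (hu.of_le (by norm_cast))
    hc.le hrep hlt.le
  have hint0 : 0 ≤ ∫ y, f y := integral_nonneg hf0
  have hα0 : 0 ≤ c * ∫ y, f y := mul_nonneg hc.le hint0
  refine ⟨(EReal.coe_nonneg.2 (mul_nonneg (by linarith) hα0)).trans hmass, fun h => ?_, ?_⟩
  · rw [h] at hmass
    have hle : (2 - c * ∫ y, f y) * (c * ∫ y, f y) ≤ 0 := by exact_mod_cast hmass
    -- Strictness of `α < 2` matters here: `(2 - α) α ≤ 0` then excludes `α > 0`.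
    have hzero : ∫ y, f y = 0 := by
      by_contra hne
      have : 0 < ∫ y, f y := lt_of_le_of_ne hint0 (Ne.symm hne)
      exact absurd hle (not_le.2 (mul_pos (by linarith) (mul_pos hc this)))
    have hae := (integral_eq_zero_iff_of_nonneg hf0 hfi).1 hzero
    have hf00 : f = 0 := (hf.ae_eq_iff_eq volume continuous_zero).1 hae
    refine ⟨C, fun x => ?_⟩
    rw [hrep x, ← hf_def, hf00]
    simp
  · rintro ⟨a, ha⟩
    rw [funext ha]
    exact ConformalMass.conformalMass_const a
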